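/- **Conventions.** Let $D\ge 1$ and $N\ge 1$ be integers and let $\kappa>0$ be real. All partition functions are formal: the exponential of the interaction is expanded and integrated term by term against the Gaussian, and the measures $dT\,d\bar T$ on complex tensors $T=(T_{n_1\dots n_D})_{1\le n_c\le N}$ and $dM$ on the space $H_N$ of Hermitian $N\times N$ matrices are normalised so that the Gaussian weight has total mass $1$. The partition function of the $D$-dimensional quartic melonic tensor model is the formal power series in $\lambda$ $$Z[\lambda,N]=\int dT\,d\bar T\,\exp\Bigl(N^{D-1}\Bigl(-\kappa\,\bar T\cdot T-\frac{\lambda}{4}\sum_{a=1}^{D}\mathrm{Tr}\bigl((\Theta^a)^2\bigr)\Bigr)\Bigr),$$ where $\Theta^a=\bar T\cdot_{\hat a}T$ is the $N\times N$ matrix obtained from $\bar T$ and $T$ by contracting all indices except the one in position $a$. The Hermitian one-matrix model is the formal power series in the times $t_0,t_1,\dots$ $$Z_{1MM}[\{t_p\}]=\int_{H_N}dM\,\exp\Bigl(-\frac N2\mathrm{Tr}(M^2)-N\sum_{p\ge0}t_p\,\mathrm{Tr}(M^p)\Bigr).$$ On formal power series in the times $t^i_p$ ($1\le i\le D$, $p\ge0$),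 with coefficients in $\mathbb C[[\sqrt\lambda]]$ and with coefficientwise convergence, let $\hat X=-\sum_{i,p}t^i_p\,\partial/\partial t^i_p$, $$\hat Y=\frac{(-1)^D}{N^D}\sum_{q\in\mathbb N^D\setminus\{0\}}\frac{(-i)^{|q|}}{|q|}\Bigl(\frac1\kappa\sqrt{\frac{\lambda}{2N^{D-2}}}\Bigr)^{|q|}\binom{|q|}{q_1,\dots,q_D}\frac{\partial^D}{\partial t^1_{q_1}\cdots\partial t^D_{q_D}},\qquad |q|=q_1+\dots+q_D,$$ $$\hat{\mathcal O}=\hat X+\frac D2\,\frac{e^{D/2}}{\sinh(D/2)}\,\hat Y .$$ **Theorem.** The series that define $\hat X$, $\hat Y$, $e^{\hat X}$, $e^{\hat Y}$ and $e^{\hat{\mathcal O}}$ converge coefficientwise on every formal power series in the times, and, as operators, $[\hat X,\hat Y]=D\,\hat Y$, $\;e^{\hat{\mathcal O}}=e^{\hat X}e^{\hat Y}$, $\;\hat{\mathcal O}=\ln(e^{\hat X}e^{\hat Y})$ (the series $\sum_{n\ge1}\frac{(-1)^{n+1}}{n}(e^{\hat X}e^{\hat Y}-1)^n$ converges to $\hat{\mathcal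 O}$), and $\hat{\mathcal O}=\hat X+\frac{D}{1-e^{-D}}\hat Y$. Moreover, at vanishing times, $$Z[\lambda,N]=\Bigl(e^{\hat X}e^{\hat Y}\prod_{i=1}^{D}Z_{1MM}[\{t^i_p\}]\Bigr)\Big|_{t=0}=\Bigl(e^{\hat{\mathcal O}}\prod_{i=1}^{D}Z_{1MM}[\{t^i_p\}]\Bigr)\Big|_{t=0}.$$ -/

import Mathlib

open scoped PowerSeries MvPowerSeries.WithPiTopology

noncomputable section

namespace QuarticTensor

/-! ### Normalised Gaussian expectations -/

/-- The Hermitian matrix with real coordinates `A`: the diagonal entries are `A j j`, and for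
`j < k` the entry `(j, k)` is `A j k + i * A k j`. This is a linear isomorphism from the real
`N × N` arrays onto the space `H_N` of Hermitian matrices, so that it carries the Lebesgue measure
to a Lebesgue measure `dM` on `H_N`. -/
def hermitianOf {N : ℕ} (A : Fin N → Fin N → ℝ) : Matrix (Fin N) (Fin N) ℂ :=
  Matrix.of fun j k =>
    if j < k then (A j k : ℂ) + Complex.I * (A k j : ℂ)
    else if j = k then (A j j : ℂ)
    else (A k j : ℂ) - Complex.I * (A j k : ℂ)

theorem hermitianOf_isHermitian {N : ℕ} (A : Fin N → Fin N → ℝ) :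
    (hermitianOf A).IsHermitian := by
  ext j k
  rcases lt_trichotomy j k with h | h | h
  · simp [hermitianOf, h, h.not_gt, h.ne', sub_eq_add_neg]
  · subst h; simp [hermitianOf]
  · simp [hermitianOf, h, h.not_gt, h.ne', sub_eq_add_neg]

/-- The real coordinates of a Hermitian matrix are unique. -/
theorem hermitianOf_injective {N : ℕ} :
    Function.Injective (hermitianOf : (Fin N → Fin N → ℝ) → Matrix (Fin N) (Fin N) ℂ) := by
  intro A B h
  funext j k
  rcases lt_trichotomy j k with hl | hl | hl
  · have := congrArg Complex.re (congrFun (congrFun h j) k)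
    simpa [hermitianOf, hl] using this
  · subst hl
    have := congrArg Complex.re (congrFun (congrFun h j) j)
    simpa [hermitianOf] using this
  · have := congrArg Complex.im (congrFun (congrFun h k) j)
    simpa [hermitianOf, hl] using this

/-- Every Hermitian matrix has real coordinates. -/
theorem exists_hermitianOf {N : ℕ} (M : Matrix (Fin N) (Fin N) ℂ) (hM : M.IsHermitian) :
    ∃ A, hermitianOf A = M := by
  refine ⟨fun j k => if j ≤ k then (M j k).re else (M k j).im, ?_⟩
  ext j k
  have hs : M j k = star (M k j) := (hM.apply j k).symm
  rcases lt_trichotomy j k with h | h | h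
  · apply Complex.ext <;> simp [hermitianOf, h, h.le, h.not_ge]
  · subst h
    have him : (M j j).im = 0 := by
      have := congrArg Complex.im hs
      simp at this
      linarith
    apply Complex.ext <;> simp [hermitianOf, him]
  · rw [hs]
    apply Complex.ext <;> simp [hermitianOf, h.le, h.not_ge, h.not_gt, h.ne']

/-- The Gaussian weight `exp (-(N/2) Tr M²)`. -/
def matrixWeight {N : ℕ} (M : Matrix (Fin N) (Fin N) ℂ) : ℝ :=
  Real.exp (-((N : ℝ) / 2) * (M * M).trace.re)

/-- `∫_{H_N} dM F(M) exp (-(N/2) Tr M²)`, with `dM` normalised so that `F = 1` gives `1`. -/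
def matrixExpect (N : ℕ) (F : Matrix (Fin N) (Fin N) ℂ → ℂ) : ℂ :=
  (∫ A : Fin N → Fin N → ℝ, F (hermitianOf A) * (matrixWeight (hermitianOf A) : ℂ)) /
    ((∫ A : Fin N → Fin N → ℝ, matrixWeight (hermitianOf A) : ℝ) : ℂ)

/-- Complex tensors of rank `D` and size `N`, through their components `T_{n_1 ... n_D}`. -/
abbrev Tensor (D N : ℕ) := (Fin D → Fin N) → ℂ

/-- The Gaussian weight `exp (-κ N^(D-1) (T̄ · T))`. -/
def tensorWeight {D N : ℕ} (κ : ℝ) (T : Tensor D N) : ℝ :=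
  Real.exp (-(κ * (N : ℝ) ^ ((D : ℤ) - 1) * ∑ n, Complex.normSq (T n)))

/-- `∫ dT dT̄ F(T) exp (-κ N^(D-1) (T̄ · T))`, with the Lebesgue measure `dT dT̄` normalised so
that `F = 1` gives `1`. -/
def tensorExpect (D N : ℕ) (κ : ℝ) (F : Tensor D N → ℂ) : ℂ :=
  (∫ T : Tensor D N, F T * (tensorWeight κ T : ℂ)) / ((∫ T : Tensor D N, tensorWeight κ T : ℝ) : ℂ)

/-! ### The quartic melonic tensor model -/

/-- The `N × N` matrix `T̄ ·_{â} T`, in which all indices but the one in position `a` are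
contracted: its `(s, s')` entry is the sum of `T̄_{... s ...} T_{... s' ...}`, where the indices
shown stand in position `a` and the other ones agree. -/
def partialContraction {D N : ℕ} (T : Tensor D N) (a : Fin D) : Matrix (Fin N) (Fin N) ℂ :=
  Matrix.of fun s s' =>
    ∑ n : Fin D → Fin N, if n a = s then star (T n) * T (Function.update n a s') else 0

/-- The quartic melonic interaction `∑_a (T̄ ·_{â} T) ·_a (T̄ ·_{â} T)`. -/
def melonicInteraction {D N : ℕ} (T : Tensor D N) : ℂ :=
  ∑ a : Fin D, (partialContraction T a * partialContraction T a).trace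

/-- The partition function
`Z[λ, N] = ∫ dT dT̄ exp (N^(D-1) (-κ (T̄ · T) - (λ/4) ∑_a (T̄ ·_{â} T) ·_a (T̄ ·_{â} T)))`
as a formal power series in `λ`: the exponential of the interaction is expanded and integrated
term by term. -/
def tensorPartition (D N : ℕ) (κ : ℝ) : ℂ⟦X⟧ :=
  PowerSeries.mk fun n => tensorExpect D N κ fun T =>
    (-((N : ℂ) ^ ((D : ℤ) - 1) / 4) * melonicInteraction T) ^ n / (n.factorial : ℂ)

/-! ### The Hermitian one-matrix model -/

/-- The partition function
`Z_{1MM}[{t_p}] = ∫_{H_N} dM exp (-(N/2) Tr M² - N ∑_{p ≥ 0} t_p Tr M^p)`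
as a formal power series in the times `t_0, t_1, ...`: the coefficient of `∏ t_p ^ (α p)` is the
Gaussian expectation of `∏ (-N Tr M^p) ^ (α p) / (α p)!`. -/
def oneMatrixPartition (N : ℕ) : MvPowerSeries ℕ ℂ :=
  fun α => matrixExpect N fun M =>
    α.prod fun p k => (-(N : ℂ) * (M ^ p).trace) ^ k / (k.factorial : ℂ)

/-- Formal power series in the times `t^i_p`, `i = 1, ..., D` and `p ≥ 0`, whose coefficients are
formal power series in one more variable `PowerSeries.X`, which stands for `√λ`. The topology on
this ring is that of coefficientwise convergence, with the usual topology of `ℂ`. -/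
abbrev TimeSeries (D : ℕ) := MvPowerSeries (Fin D × ℕ) ℂ⟦X⟧

/-- `∏_{i=1}^D Z_{1MM}[{t^i_p}]`. -/
def matrixProduct (D N : ℕ) : TimeSeries D :=
  ∏ i : Fin D, MvPowerSeries.rename (Function.Embedding.sectR i ℕ)
    (MvPowerSeries.map (PowerSeries.C (R := ℂ)) (oneMatrixPartition N))

/-! ### The differential operators -/

/-- The summands `t^i_p ∂/∂t^i_p F`. -/
def eulerTerm {D : ℕ} (F : TimeSeries D) (v : Fin D × ℕ) : TimeSeries D :=
  MvPowerSeries.X v * MvPowerSeries.pderiv ℂ⟦X⟧ v F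

/-- `X̂ = -∑_{i,p} t^i_p ∂/∂t^i_p`. -/
def opX {D : ℕ} (F : TimeSeries D) : TimeSeries D := -∑' v : Fin D × ℕ, eulerTerm F v

/-- `∂^D / (∂t^1_{q_1} ... ∂t^D_{q_D})`. -/
def mixedDeriv {D : ℕ} (q : Fin D → ℕ) (F : TimeSeries D) : TimeSeries D :=
  (List.finRange D).foldr (fun i G => MvPowerSeries.pderiv ℂ⟦X⟧ (i, q i) G) F

/-- `κ⁻¹ √(λ / (2 N^(D-2)))`, where `√λ` is the formal variable. -/
def rootCoupling (D N : ℕ) (κ : ℝ) : ℂ⟦X⟧ :=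
  PowerSeries.C ((κ⁻¹ * (√(2 * (N : ℝ) ^ ((D : ℤ) - 2)))⁻¹ : ℝ) : ℂ) * PowerSeries.X

/-- The coefficient `((-1)^D / N^D) ((-i)^|q| / |q|) (κ⁻¹ √(λ / (2 N^(D-2))))^|q| (|q| choose q)`,
where `|q| = q_1 + ... + q_D`. -/
def coeffY (D N : ℕ) (κ : ℝ) (q : Fin D → ℕ) : ℂ⟦X⟧ :=
  PowerSeries.C ((-1) ^ D / (N : ℂ) ^ D * ((-Complex.I) ^ (∑ i, q i) / ((∑ i, q i : ℕ) : ℂ))) *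
    rootCoupling D N κ ^ (∑ i, q i) *
    PowerSeries.C ((Nat.multinomial Finset.univ q : ℕ) : ℂ)

/-- The summands of `Ŷ F`, one for each nonzero `q ∈ ℕ^D`. -/
def termY {D : ℕ} (N : ℕ) (κ : ℝ) (F : TimeSeries D) (q : {q : Fin D → ℕ // q ≠ 0}) :
    TimeSeries D :=
  coeffY D N κ q.1 • mixedDeriv q.1 F

/-- The operator `Ŷ`. -/
def opY {D : ℕ} (N : ℕ) (κ : ℝ) (F : TimeSeries D) : TimeSeries D :=
  ∑' q : {q : Fin D → ℕ // q ≠ 0}, termY N κ F q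

/-- `Ô = X̂ + (D/2) (exp (D/2) / sinh (D/2)) Ŷ`. -/
def opO {D : ℕ} (N : ℕ) (κ : ℝ) (F : TimeSeries D) : TimeSeries D :=
  opX F + (((D : ℝ) / 2 * (Real.exp ((D : ℝ) / 2) / Real.sinh ((D : ℝ) / 2)) : ℝ) : ℂ) • opY N κ F

/-- The summands of `e^P F = ∑_n P^n F / n!`. -/
def expTerm {D : ℕ} (P : TimeSeries D → TimeSeries D) (F : TimeSeries D) (n : ℕ) : TimeSeries D :=
  ((n.factorial : ℂ)⁻¹) • P^[n] F

/-- The exponential `e^P F = ∑_n P^n F / n!` of an operator, in the sense of coefficientwise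
convergence. -/
def opExp {D : ℕ} (P : TimeSeries D → TimeSeries D) (F : TimeSeries D) : TimeSeries D :=
  ∑' n : ℕ, expTerm P F n

/-- The summands of `(ln E) F = ∑_{n ≥ 0} (-1)^n (E - 1)^(n+1) F / (n+1)`. -/
def logTerm {D : ℕ} (E : TimeSeries D → TimeSeries D) (F : TimeSeries D) (n : ℕ) : TimeSeries D :=
  ((-1 : ℂ) ^ n / ((n : ℂ) + 1)) • (fun G => E G - G)^[n + 1] F

end QuarticTensor

end

open QuarticTensor

noncomputable section

namespace QuarticTensor

/-! ### Coefficients of formal power series in the times -/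

/-! Operators. `X̂` is diagonal on monomials in the times, with eigenvalue `-d` in degree `d`, while
`Ŷ` lowers that degree by `D` and raises the order in `√λ` by at least one. The first two facts give
`[X̂, Ŷ] = D Ŷ`; the third makes every formal power series in `Ŷ` a finite sum at each order, so
that the `e^{aŶ}` form a one-parameter group. With `c = 1/(1 - e^{-D})` one has both `Ô = e^{-cŶ} X̂
e^{cŶ}` (`opO_eq_conj`) and `e^X̂ e^Ŷ = e^{-cŶ} e^X̂ e^{cŶ}` (`opExp_opX_opExp_opY_eq_conj`). No
Baker-Campbell-Hausdorff series is needed: after conjugation the exponential of `Ô` and the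
logarithm of `e^X̂ e^Ŷ` are scalar series at `-d` and at `e^{-d}`.

Vanishing times. The product of one-matrix models is the expectation of `exp (∑ t^i_p y_{i,p})`,
where `y_{i,p} = -N Tr M_i^p` and the `M_i` are independent Gaussian Hermitian matrices. A time
derivative multiplies the integrand by some `y_{i,p}`, so `Ŷ` multiplies it by a series `W`
(`linY_sourceSeries`), and `e^X̂` is invisible at `t = 0`; what remains is the expectation of `e^W`.
Let `z = -i κ⁻¹ √(λ / (2 N^(D-2)))` and let `a_i` list the eigenvalues of `M_i`. By the multinomial
theorem `W = ∑_n ∑_{k ≥ 1} (z ∑_i a_i(n_i))^k / k`, hence `e^W = ∏_n 1 / (1 - z ∑_i a_i(n_i))`. This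
inverse determinant is a Gaussian tensor integral of the exponential of a multiple of `∑_i Tr (M_i
Θ_i^t)` (`coeff_exp_subst_symbolY`). Exchanging the integrals and integrating over the matrices
first produces the quartic interaction (`mk_integral_fieldForm`): the Hubbard-Stratonovich
transformation read backwards. Everything is done order by order in `√λ`, so only Gaussian moments
of polynomials occur. -/

theorem HasSum.of_forall_eq {ι M : Type*} [AddCommMonoid M] [TopologicalSpace M] {f g : ι → M}
    {a : M} (h : HasSum g a) (hfg : ∀ i, f i = g i) : HasSum f a :=
  funext hfg ▸ h

/-- The coefficient of `t ^ α * √λ ^ k`. -/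
def timeCoeff {D : ℕ} (α : Fin D × ℕ →₀ ℕ) (k : ℕ) : TimeSeries D →ₗ[ℂ] ℂ where
  toFun F := PowerSeries.coeff k (MvPowerSeries.coeff α F)
  map_add' F G := by simp
  map_smul' c F := by
    rw [RingHom.id_apply]
    rfl

theorem timeCoeff_apply {D : ℕ} (α : Fin D × ℕ →₀ ℕ) (k : ℕ) (F : TimeSeries D) :
    timeCoeff α k F = PowerSeries.coeff k (MvPowerSeries.coeff α F) := rfl

theorem timeSeries_ext {D : ℕ} {F G : TimeSeries D}
    (h : ∀ α k, timeCoeff α k F = timeCoeff α k G) : F = G := by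
  ext α k
  exact h α k

/-- The time series with given coefficients. -/
def ofCoeffs {D : ℕ} (f : (Fin D × ℕ →₀ ℕ) → ℕ → ℂ) : TimeSeries D :=
  fun α => PowerSeries.mk (f α)

@[simp] theorem timeCoeff_ofCoeffs {D : ℕ} (f : (Fin D × ℕ →₀ ℕ) → ℕ → ℂ)
    (α : Fin D × ℕ →₀ ℕ) (k : ℕ) : timeCoeff α k (ofCoeffs f) = f α k := by
  change PowerSeries.coeff k (PowerSeries.mk (f α)) = _
  simp

/-- Both layers of power series carry the product topology, so every convergence claim reduces to
sums of complex numbers. -/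
theorem hasSum_iff_timeCoeff {D : ℕ} {ι : Type*} {f : ι → TimeSeries D} {F : TimeSeries D} :
    HasSum f F ↔ ∀ α k, HasSum (fun i => timeCoeff α k (f i)) (timeCoeff α k F) := by
  rw [MvPowerSeries.WithPiTopology.hasSum_iff_hasSum_coeff]
  refine forall_congr' fun α => ?_
  rw [PowerSeries.WithPiTopology.hasSum_iff_hasSum_coeff]
  rfl

theorem HasSum.unique_timeSeries {D : ℕ} {ι : Type*} {f : ι → TimeSeries D} {F G : TimeSeries D}
    (h : HasSum f F) (h' : HasSum f G) : F = G :=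
  timeSeries_ext fun α k =>
    (hasSum_iff_timeCoeff.1 h α k).unique (hasSum_iff_timeCoeff.1 h' α k)

theorem HasSum.tsum_timeSeries {D : ℕ} {ι : Type*} {f : ι → TimeSeries D} {F : TimeSeries D}
    (h : HasSum f F) : ∑' i, f i = F :=
  HasSum.unique_timeSeries h.summable.hasSum h

/-! ### The Euler operator -/

theorem timeCoeff_eulerTerm {D : ℕ} (F : TimeSeries D) (v : Fin D × ℕ)
    (α : Fin D × ℕ →₀ ℕ) (k : ℕ) :
    timeCoeff α k (eulerTerm F v) = (α v : ℂ) * timeCoeff α k F := by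
  classical
  rw [timeCoeff_apply, eulerTerm, MvPowerSeries.X_def, MvPowerSeries.coeff_monomial_mul]
  split_ifs with h
  · have h1 : 1 ≤ α v := by simpa using h v
    rw [MvPowerSeries.coeff_pderiv, tsub_add_cancel_of_le h, one_mul]
    rw [timeCoeff_apply]
    have : (((α - Finsupp.single v 1 : Fin D × ℕ →₀ ℕ) v : ℕ) : ℂ⟦X⟧) + 1 =
        PowerSeries.C (α v : ℂ) := by
      simp [Nat.cast_sub h1]
    rw [this, mul_comm, PowerSeries.coeff_C_mul]
  · have h1 : α v = 0 := by
      by_contra h0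
      exact h (by simpa using Nat.one_le_iff_ne_zero.2 h0)
    simp [h1]

theorem hasSum_eulerTerm {D : ℕ} (F : TimeSeries D) :
    HasSum (eulerTerm F) (ofCoeffs fun α k => (α.degree : ℂ) * timeCoeff α k F) := by
  rw [hasSum_iff_timeCoeff]
  intro α k
  simp only [timeCoeff_eulerTerm, timeCoeff_ofCoeffs]
  have : (α.degree : ℂ) = ∑ v ∈ α.support, (α v : ℂ) := by
    simp [Finsupp.degree_apply]
  rw [this, Finset.sum_mul]
  refine hasSum_sum_of_ne_finset_zero fun v hv => ?_
  simp [Finsupp.notMem_support_iff.1 hv]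

@[simp] theorem timeCoeff_opX {D : ℕ} (F : TimeSeries D) (α : Fin D × ℕ →₀ ℕ) (k : ℕ) :
    timeCoeff α k (opX F) = -(α.degree : ℂ) * timeCoeff α k F := by
  rw [opX, HasSum.tsum_timeSeries (hasSum_eulerTerm F), map_neg, timeCoeff_ofCoeffs, neg_mul]

/-- The operator that multiplies the coefficients of degree `d` in the times by `f d`. -/
def degreeScale {D : ℕ} (f : ℕ → ℂ) : TimeSeries D →ₗ[ℂ] TimeSeries D where
  toFun F := ofCoeffs fun α k => f α.degree * timeCoeff α k F
  map_add' F G := timeSeries_ext fun α k => by simp [mul_add]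
  map_smul' c F := timeSeries_ext fun α k => by simp; ring

@[simp] theorem timeCoeff_degreeScale {D : ℕ} (f : ℕ → ℂ) (F : TimeSeries D)
    (α : Fin D × ℕ →₀ ℕ) (k : ℕ) :
    timeCoeff α k (degreeScale f F) = f α.degree * timeCoeff α k F :=
  timeCoeff_ofCoeffs (fun α k => f α.degree * timeCoeff α k F) α k

theorem opX_eq_degreeScale {D : ℕ} (F : TimeSeries D) :
    opX F = degreeScale (fun d => -(d : ℂ)) F :=
  timeSeries_ext fun α k => by simp

theorem iterate_degreeScale {D : ℕ} (f : ℕ → ℂ) (n : ℕ) (F : TimeSeries D) :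
    (degreeScale f)^[n] F = degreeScale (f ^ n) F := by
  induction n with
  | zero => exact timeSeries_ext fun α k => by simp
  | succ n ih =>
    rw [Function.iterate_succ_apply', ih]
    exact timeSeries_ext fun α k => by simp; ring

/-- A diagonal operator needs only a convergent scalar series in each degree, with no uniformity in
`d`. This serves both the exponential and the logarithm. -/
theorem hasSum_smul_iterate_degreeScale {D : ℕ} {c : ℕ → ℂ} {e : ℕ → ℕ} {f g : ℕ → ℂ}
    (h : ∀ d, HasSum (fun n => c n * f d ^ e n) (g d)) (F : TimeSeries D) :
    HasSum (fun n => c n • (degreeScale f)^[e n] F) (degreeScale g F) := by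
  rw [hasSum_iff_timeCoeff]
  intro α k
  simp only [iterate_degreeScale, map_smul, timeCoeff_degreeScale, smul_eq_mul, Pi.pow_apply]
  simp only [← mul_assoc]
  exact (h α.degree).mul_right _

theorem hasSum_expTerm_opX {D : ℕ} (F : TimeSeries D) :
    HasSum (expTerm opX F) (degreeScale (fun d => Complex.exp (-(d : ℂ))) F) := by
  have : (opX : TimeSeries D → TimeSeries D) = degreeScale (fun d => -(d : ℂ)) :=
    funext opX_eq_degreeScale
  rw [funext fun n => (by rw [expTerm, this] : expTerm opX F n = _)]
  refine hasSum_smul_iterate_degreeScale (e := id) (fun d => ?_) F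
  simpa [Complex.exp_eq_exp_ℂ, div_eq_inv_mul] using
    NormedSpace.expSeries_div_hasSum_exp (-(d : ℂ))

theorem opExp_opX {D : ℕ} (F : TimeSeries D) :
    opExp opX F = degreeScale (fun d => Complex.exp (-(d : ℂ))) F :=
  HasSum.tsum_timeSeries (hasSum_expTerm_opX F)

/-- The eigenvalues `e^{-d}` of `e^X̂` lie in `(0, 1]`, so `e^{-d} - 1` is inside the disc of
convergence of the logarithm. -/
theorem hasSum_log_degreeScale {D : ℕ} (F : TimeSeries D) :
    HasSum (fun n : ℕ => ((-1 : ℂ) ^ n / ((n : ℂ) + 1)) •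
      (degreeScale (fun d => Complex.exp (-(d : ℂ)) - 1))^[n + 1] F) (opX F) := by
  rw [opX_eq_degreeScale]
  refine hasSum_smul_iterate_degreeScale (fun d => ?_) F
  have hz : ‖Complex.exp (-(d : ℂ)) - 1‖ < 1 := by
    rw [← Complex.ofReal_natCast, ← Complex.ofReal_neg, ← Complex.ofReal_exp, ← Complex.ofReal_one,
      ← Complex.ofReal_sub, Complex.norm_real, Real.norm_eq_abs, abs_lt]
    have := Real.exp_pos (-(d : ℝ))
    have h1 : Real.exp (-(d : ℝ)) ≤ 1 := Real.exp_le_one_iff.2 (by simp)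
    constructor <;> linarith
  have := Complex.hasSum_taylorSeries_log hz
  rw [add_sub_cancel] at this
  rw [← Complex.ofReal_natCast, ← Complex.ofReal_neg, ← Complex.ofReal_exp,
    ← Complex.ofReal_log (Real.exp_pos _).le, Real.log_exp] at this
  -- The Taylor series of the logarithm is indexed from `0`; its initial term is a division by zero,
  -- hence `0`, and is dropped.
  rw [← hasSum_nat_add_iff' 1] at this
  simp at this
  refine HasSum.of_forall_eq this fun n => ?_
  ring

/-! ### The operator `Ŷ` -/

/-- The exponent of `∏ t^i_{q_i}`. -/
def timeExponent {D : ℕ} (q : Fin D → ℕ) : Fin D × ℕ →₀ ℕ :=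
  ((List.finRange D).map fun i => Finsupp.single (i, q i) 1).sum

theorem degree_timeExponent {D : ℕ} (q : Fin D → ℕ) : (timeExponent q).degree = D := by
  have (l : List (Fin D)) :
      ((l.map fun i => Finsupp.single (i, q i) 1).sum : Fin D × ℕ →₀ ℕ).degree = l.length := by
    induction l with
    | nil => simp
    | cons i l ih => simp [ih, add_comm]
  simpa [timeExponent] using this (List.finRange D)

/-- The value of the integer is never used, only that it does not depend on `F`. -/
theorem exists_coeff_mixedDeriv {D : ℕ} (q : Fin D → ℕ) (α : Fin D × ℕ →₀ ℕ) :
    ∃ m : ℕ, ∀ F : TimeSeries D, MvPowerSeries.coeff α (mixedDeriv q F) =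
      (m : ℂ⟦X⟧) * MvPowerSeries.coeff (α + timeExponent q) F := by
  unfold mixedDeriv timeExponent
  generalize List.finRange D = l
  induction l generalizing α with
  | nil => exact ⟨1, fun F => by simp⟩
  | cons i l ih =>
    obtain ⟨m, hm⟩ := ih (α + Finsupp.single (i, q i) 1)
    refine ⟨m * (α (i, q i) + 1), fun F => ?_⟩
    rw [List.foldr_cons, MvPowerSeries.coeff_pderiv, hm, List.map_cons, List.sum_cons, add_assoc]
    push_cast
    ring

/-- The integer by which `mixedDeriv q` multiplies the coefficient that it moves to `α`. -/
def mixedDerivFactor {D : ℕ} (q : Fin D → ℕ) (α : Fin D × ℕ →₀ ℕ) : ℕ :=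
  (exists_coeff_mixedDeriv q α).choose

theorem coeff_mixedDeriv {D : ℕ} (q : Fin D → ℕ) (α : Fin D × ℕ →₀ ℕ) (F : TimeSeries D) :
    MvPowerSeries.coeff α (mixedDeriv q F) =
      (mixedDerivFactor q α : ℂ⟦X⟧) * MvPowerSeries.coeff (α + timeExponent q) F :=
  (exists_coeff_mixedDeriv q α).choose_spec F

/-- The numerical factor of `coeffY`. -/
def scalarY (D N : ℕ) (κ : ℝ) (q : Fin D → ℕ) : ℂ :=
  (-1) ^ D / (N : ℂ) ^ D * ((-Complex.I) ^ (∑ i, q i) / ((∑ i, q i : ℕ) : ℂ)) *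
    ((κ⁻¹ * (√(2 * (N : ℝ) ^ ((D : ℤ) - 2)))⁻¹ : ℝ) : ℂ) ^ (∑ i, q i) *
    (Nat.multinomial Finset.univ q : ℂ)

theorem coeffY_eq (D N : ℕ) (κ : ℝ) (q : Fin D → ℕ) :
    coeffY D N κ q = PowerSeries.C (scalarY D N κ q) * PowerSeries.X ^ (∑ i, q i) := by
  simp only [coeffY, rootCoupling, scalarY, map_mul, map_pow, mul_pow]
  ring

section OperatorY

variable {D N : ℕ} {κ : ℝ}

theorem timeCoeff_termY (F : TimeSeries D) (q : {q : Fin D → ℕ // q ≠ 0})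
    (α : Fin D × ℕ →₀ ℕ) (k : ℕ) :
    timeCoeff α k (termY N κ F q) = if ∑ i, q.1 i ≤ k then
      scalarY D N κ q.1 * mixedDerivFactor q.1 α *
        timeCoeff (α + timeExponent q.1) (k - ∑ i, q.1 i) F else 0 := by
  have h : MvPowerSeries.coeff α (termY N κ F q) =
      PowerSeries.C (scalarY D N κ q.1 * (mixedDerivFactor q.1 α : ℂ)) *
        (PowerSeries.X ^ (∑ i, q.1 i) * MvPowerSeries.coeff (α + timeExponent q.1) F) := by
    rw [termY, MvPowerSeries.coeff_smul, coeff_mixedDeriv, coeffY_eq]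
    simp only [map_mul, map_natCast]
    ring
  rw [timeCoeff_apply, h, PowerSeries.coeff_C_mul, PowerSeries.coeff_X_pow_mul']
  split_ifs <;> simp [timeCoeff_apply]

/-- The nonzero `q` with `|q| ≤ k`. -/
def boundedExponents (D k : ℕ) : Finset {q : Fin D → ℕ // q ≠ 0} :=
  ((Finset.range (k + 1)).biUnion fun j => Finset.univ.piAntidiag j).subtype (· ≠ 0)

theorem mem_boundedExponents {k : ℕ} {q : {q : Fin D → ℕ // q ≠ 0}} :
    q ∈ boundedExponents D k ↔ ∑ i, q.1 i ≤ k := by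
  simp [boundedExponents]

theorem sum_pos_of_ne_zero (q : {q : Fin D → ℕ // q ≠ 0}) : 0 < ∑ i, q.1 i := by
  obtain ⟨i, hi⟩ := Function.ne_iff.1 q.2
  exact Finset.sum_pos' (fun _ _ => Nat.zero_le _) ⟨i, Finset.mem_univ i, Nat.pos_of_ne_zero hi⟩

/-- `Ŷ` through its action on coefficients. -/
def linY (D N : ℕ) (κ : ℝ) : TimeSeries D →ₗ[ℂ] TimeSeries D where
  toFun F := ofCoeffs fun α k => ∑ q ∈ boundedExponents D k,
    scalarY D N κ q.1 * mixedDerivFactor q.1 α *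
      timeCoeff (α + timeExponent q.1) (k - ∑ i, q.1 i) F
  map_add' F G := timeSeries_ext fun α k => by simp [mul_add, Finset.sum_add_distrib]
  map_smul' c F := timeSeries_ext fun α k => by
    simp only [timeCoeff_ofCoeffs, map_smul, smul_eq_mul, RingHom.id_apply, Finset.mul_sum]
    exact Finset.sum_congr rfl fun _ _ => by ring

theorem timeCoeff_linY (F : TimeSeries D) (α : Fin D × ℕ →₀ ℕ) (k : ℕ) :
    timeCoeff α k (linY D N κ F) = ∑ q ∈ boundedExponents D k,
      scalarY D N κ q.1 * mixedDerivFactor q.1 α *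
        timeCoeff (α + timeExponent q.1) (k - ∑ i, q.1 i) F :=
  timeCoeff_ofCoeffs (fun α k => ∑ q ∈ boundedExponents D k,
    scalarY D N κ q.1 * mixedDerivFactor q.1 α *
      timeCoeff (α + timeExponent q.1) (k - ∑ i, q.1 i) F) α k

/-- The summand at `q` is divisible by `√λ ^ |q|`, and only finitely many `q` have `|q| ≤ k`. -/
theorem hasSum_termY (F : TimeSeries D) : HasSum (termY N κ F) (linY D N κ F) := by
  rw [hasSum_iff_timeCoeff]
  intro α k
  rw [timeCoeff_linY]
  have : ∑ q ∈ boundedExponents D k, scalarY D N κ q.1 * mixedDerivFactor q.1 α *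
        timeCoeff (α + timeExponent q.1) (k - ∑ i, q.1 i) F =
      ∑ q ∈ boundedExponents D k, timeCoeff α k (termY N κ F q) :=
    Finset.sum_congr rfl fun q hq => by
      rw [timeCoeff_termY, if_pos (mem_boundedExponents.1 hq)]
  rw [this]
  refine hasSum_sum_of_ne_finset_zero fun q hq => ?_
  rw [timeCoeff_termY, if_neg (mt mem_boundedExponents.2 hq)]

theorem opY_eq_linY : (opY N κ : TimeSeries D → TimeSeries D) = linY D N κ :=
  funext fun F => HasSum.tsum_timeSeries (hasSum_termY F)

/-- `F` and `G` agree up to the order `√λ ^ k`. -/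
def AgreeUpTo (k : ℕ) (F G : TimeSeries D) : Prop :=
  ∀ α, ∀ j ≤ k, timeCoeff α j F = timeCoeff α j G

theorem AgreeUpTo.linY_iterate {k : ℕ} {F G : TimeSeries D} (h : AgreeUpTo k F G) (n : ℕ) :
    AgreeUpTo k ((linY D N κ ^ n) F) ((linY D N κ ^ n) G) := by
  induction n with
  | zero => simpa using h
  | succ n ih =>
    intro α j hj
    simp only [pow_succ', Module.End.mul_apply, timeCoeff_linY]
    exact Finset.sum_congr rfl fun q _ => by rw [ih _ _ ((Nat.sub_le _ _).trans hj)]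

/-- Since `q = 0` is excluded from `Ŷ`, each application raises the order in `√λ` by at least one.
This is what makes all power series in `Ŷ` converge. -/
theorem timeCoeff_linY_pow_eq_zero (F : TimeSeries D) {n k : ℕ} (h : k < n)
    (α : Fin D × ℕ →₀ ℕ) : timeCoeff α k ((linY D N κ ^ n) F) = 0 := by
  induction n generalizing k α with
  | zero => omega
  | succ n ih =>
    simp only [pow_succ', Module.End.mul_apply, timeCoeff_linY]
    refine Finset.sum_eq_zero fun q hq => ?_
    have h0 := sum_pos_of_ne_zero q
    have h1 := mem_boundedExponents.1 hq
    rw [ih (by omega), mul_zero]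

/-- `Ŷ` lowers the degree in the times by `D`. -/
theorem degreeScale_linY_pow {f g : ℕ → ℂ} {n : ℕ} (h : ∀ d, f d = g (d + n * D))
    (F : TimeSeries D) :
    degreeScale f ((linY D N κ ^ n) F) = (linY D N κ ^ n) (degreeScale g F) := by
  induction n generalizing f with
  | zero =>
    have : f = g := funext fun d => by simpa using h d
    simp [this]
  | succ n ih =>
    rw [pow_succ', Module.End.mul_apply, Module.End.mul_apply,
      ← ih (f := fun d => g (d + n * D)) fun d => rfl]
    refine timeSeries_ext fun α k => ?_
    rw [timeCoeff_degreeScale, timeCoeff_linY, timeCoeff_linY, Finset.mul_sum]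
    refine Finset.sum_congr rfl fun q _ => ?_
    rw [timeCoeff_degreeScale, h, map_add, degree_timeExponent]
    rw [show α.degree + (n + 1) * D = α.degree + D + n * D by ring]
    ring

/-! ### Formal power series in `Ŷ` -/

/-- The value `f(Ŷ)` of a formal power series at the operator `Ŷ`. -/
def seriesY (N : ℕ) (κ : ℝ) (f : ℂ⟦X⟧) : TimeSeries D →ₗ[ℂ] TimeSeries D where
  toFun F := ofCoeffs fun α k => ∑ n ∈ Finset.range (k + 1),
    PowerSeries.coeff n f * timeCoeff α k ((linY D N κ ^ n) F)
  map_add' F G := timeSeries_ext fun α k => by simp [mul_add, Finset.sum_add_distrib]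
  map_smul' c F := timeSeries_ext fun α k => by
    simp only [timeCoeff_ofCoeffs, map_smul, smul_eq_mul, RingHom.id_apply, Finset.mul_sum]
    exact Finset.sum_congr rfl fun _ _ => by ring

theorem timeCoeff_seriesY {f : ℂ⟦X⟧} {F : TimeSeries D} {k m : ℕ} (h : k ≤ m)
    (α : Fin D × ℕ →₀ ℕ) :
    timeCoeff α k (seriesY N κ f F) = ∑ n ∈ Finset.range (m + 1),
      PowerSeries.coeff n f * timeCoeff α k ((linY D N κ ^ n) F) := by
  refine (timeCoeff_ofCoeffs (fun α k => ∑ n ∈ Finset.range (k + 1),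
    PowerSeries.coeff n f * timeCoeff α k ((linY D N κ ^ n) F)) α k).trans ?_
  refine Finset.sum_subset (Finset.range_subset_range.2 (by omega)) fun n _ hn => ?_
  rw [timeCoeff_linY_pow_eq_zero _ (by simpa using hn), mul_zero]

theorem hasSum_seriesY (f : ℂ⟦X⟧) (F : TimeSeries D) :
    HasSum (fun n => PowerSeries.coeff n f • (linY D N κ ^ n) F) (seriesY N κ f F) := by
  rw [hasSum_iff_timeCoeff]
  intro α k
  rw [timeCoeff_seriesY le_rfl]
  simp only [map_smul, smul_eq_mul]
  refine hasSum_sum_of_ne_finset_zero fun n hn => ?_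
  rw [timeCoeff_linY_pow_eq_zero _ (by simpa using hn), mul_zero]

theorem agreeUpTo_seriesY {k m : ℕ} (h : k ≤ m) (f : ℂ⟦X⟧) (F : TimeSeries D) :
    AgreeUpTo k (seriesY N κ f F)
      (Polynomial.aeval (linY D N κ) (PowerSeries.trunc (m + 1) f) F) := by
  intro α j hj
  rw [timeCoeff_seriesY (hj.trans h),
    Polynomial.aeval_eq_sum_range' (PowerSeries.natDegree_trunc_lt f m)]
  simp only [LinearMap.sum_apply, map_sum, LinearMap.smul_apply, map_smul, smul_eq_mul]
  refine Finset.sum_congr rfl fun n hn => ?_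
  rw [PowerSeries.coeff_trunc, if_pos (Finset.mem_range.1 hn)]

theorem AgreeUpTo.aeval {k : ℕ} {F G : TimeSeries D} (h : AgreeUpTo k F G)
    (p : Polynomial ℂ) :
    AgreeUpTo k (Polynomial.aeval (linY D N κ) p F) (Polynomial.aeval (linY D N κ) p G) := by
  intro α j hj
  simp only [Polynomial.aeval_eq_sum_range, LinearMap.sum_apply, LinearMap.smul_apply, map_sum,
    map_smul, h.linY_iterate _ α j hj]

theorem timeCoeff_aeval_eq {k : ℕ} {p r : Polynomial ℂ} (h : ∀ n ≤ k, p.coeff n = r.coeff n)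
    (F : TimeSeries D) (α : Fin D × ℕ →₀ ℕ) :
    timeCoeff α k (Polynomial.aeval (linY D N κ) p F) =
      timeCoeff α k (Polynomial.aeval (linY D N κ) r F) := by
  obtain ⟨s, hs⟩ : Polynomial.X ^ (k + 1) ∣ p - r :=
    Polynomial.X_pow_dvd_iff.2 fun n hn => by simp [h n (by omega)]
  rw [← sub_eq_zero, ← map_sub, ← LinearMap.sub_apply, ← map_sub, hs, map_mul, map_pow,
    Polynomial.aeval_X, Module.End.mul_apply, timeCoeff_linY_pow_eq_zero _ k.lt_succ_self]

/-- Up to order `√λ ^ k`, a series in `Ŷ` acts as its truncation, and polynomials in `Ŷ` multiply as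
operators. The product of the truncations differs from the truncated product only in powers of `Ŷ`
above `k`, which do not contribute. -/
theorem seriesY_mul (f g : ℂ⟦X⟧) (F : TimeSeries D) :
    seriesY N κ (f * g) F = seriesY N κ f (seriesY N κ g F) := by
  refine timeSeries_ext fun α k => ?_
  rw [agreeUpTo_seriesY le_rfl f _ α k le_rfl,
    (agreeUpTo_seriesY le_rfl g F).aeval _ α k le_rfl,
    agreeUpTo_seriesY le_rfl (f * g) F α k le_rfl, ← Module.End.mul_apply, ← map_mul]
  refine timeCoeff_aeval_eq (fun n hn => ?_) F α
  rw [PowerSeries.coeff_trunc, if_pos (by omega), Polynomial.coeff_mul, PowerSeries.coeff_mul]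
  refine Finset.sum_congr rfl fun p hp => ?_
  have := Finset.HasAntidiagonal.mem_antidiagonal.1 hp
  rw [PowerSeries.coeff_trunc, if_pos (by omega), PowerSeries.coeff_trunc, if_pos (by omega)]

theorem seriesY_one (F : TimeSeries D) : seriesY N κ 1 F = F := by
  refine timeSeries_ext fun α k => ?_
  rw [timeCoeff_seriesY le_rfl, Finset.sum_eq_single 0]
  · simp
  · intro n _ hn
    simp [PowerSeries.coeff_one, hn]
  · simp

theorem seriesY_X (F : TimeSeries D) : seriesY N κ PowerSeries.X F = linY D N κ F := by
  refine timeSeries_ext fun α k => ?_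
  rw [timeCoeff_seriesY k.le_succ, Finset.sum_eq_single 1]
  · simp
  · intro n _ hn
    simp [PowerSeries.coeff_X, hn]
  · simp

/-- Each coefficient of `f(Ŷ) F` depends linearly on finitely many coefficients of `F`. This
continuity lets infinite sums pass through the conjugation by `e^{cŶ}`. -/
theorem HasSum.seriesY {ι : Type*} {u : ι → TimeSeries D} {F : TimeSeries D} (h : HasSum u F)
    (f : ℂ⟦X⟧) : HasSum (fun i => seriesY N κ f (u i)) (seriesY N κ f F) := by
  rw [hasSum_iff_timeCoeff] at h ⊢
  have (n : ℕ) : ∀ α k, HasSum (fun i => timeCoeff α k ((linY D N κ ^ n) (u i)))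
      (timeCoeff α k ((linY D N κ ^ n) F)) := by
    induction n with
    | zero => simpa using h
    | succ n ih =>
      intro α k
      simp only [pow_succ', Module.End.mul_apply, timeCoeff_linY]
      exact hasSum_sum fun q _ => (ih _ _).mul_left _
  intro α k
  simp only [timeCoeff_seriesY le_rfl]
  exact hasSum_sum fun n _ => (this n α k).mul_left _

/-! ### The one-parameter group generated by `Ŷ` -/

/-- The operator `e^{aŶ}`. -/
def expY (N : ℕ) (κ : ℝ) (a : ℂ) : TimeSeries D →ₗ[ℂ] TimeSeries D :=
  seriesY N κ (PowerSeries.rescale a (PowerSeries.exp ℂ))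

theorem expY_add (a b : ℂ) (F : TimeSeries D) :
    expY N κ (a + b) F = expY N κ a (expY N κ b F) := by
  rw [expY, expY, expY, ← seriesY_mul, PowerSeries.exp_mul_exp_eq_exp_add]

theorem expY_zero (F : TimeSeries D) : expY N κ 0 F = F := by
  rw [expY, PowerSeries.rescale_zero]
  simp [seriesY_one]

theorem expY_neg_expY (a : ℂ) (F : TimeSeries D) : expY N κ (-a) (expY N κ a F) = F := by
  rw [← expY_add, neg_add_cancel, expY_zero]

theorem expY_expY_neg (a : ℂ) (F : TimeSeries D) : expY N κ a (expY N κ (-a) F) = F := by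
  rw [← expY_add, add_neg_cancel, expY_zero]

theorem hasSum_expTerm_opY (F : TimeSeries D) : HasSum (expTerm (opY N κ) F) (expY N κ 1 F) := by
  refine HasSum.of_forall_eq (hasSum_seriesY _ F) fun n => ?_
  rw [expTerm, opY_eq_linY, ← Module.End.coe_pow, PowerSeries.coeff_rescale, PowerSeries.coeff_exp]
  simp

theorem opExp_opY (F : TimeSeries D) : opExp (opY N κ) F = expY N κ 1 F :=
  HasSum.tsum_timeSeries (hasSum_expTerm_opY F)

/-- `e^X̂ e^{aŶ} = e^{a e^D Ŷ} e^X̂`. -/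
theorem degreeScale_exp_expY (a : ℂ) (F : TimeSeries D) :
    degreeScale (fun d => Complex.exp (-(d : ℂ))) (expY N κ a F) =
      expY N κ (a * Complex.exp D) (degreeScale (fun d => Complex.exp (-(d : ℂ))) F) := by
  refine timeSeries_ext fun α k => ?_
  rw [timeCoeff_degreeScale, expY, timeCoeff_seriesY le_rfl, expY, timeCoeff_seriesY le_rfl,
    Finset.mul_sum]
  refine Finset.sum_congr rfl fun n _ => ?_
  rw [← degreeScale_linY_pow (f := fun d => Complex.exp (-((d + n * D : ℕ) : ℂ))) fun d => rfl,
    timeCoeff_degreeScale, PowerSeries.coeff_rescale, PowerSeries.coeff_rescale, mul_pow,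
    ← Complex.exp_nat_mul]
  have : Complex.exp (-(α.degree : ℂ)) =
      Complex.exp (n * D) * Complex.exp (-((α.degree + n * D : ℕ) : ℂ)) := by
    rw [← Complex.exp_add]
    push_cast
    ring_nf
  rw [this]
  ring

/-- `X̂ e^{aŶ} = e^{aŶ} (X̂ + a D Ŷ)`. -/
theorem opX_expY (a : ℂ) (F : TimeSeries D) :
    opX (expY N κ a F) = expY N κ a (opX F + (a * D) • linY D N κ F) := by
  rw [← seriesY_X, map_add, map_smul]
  rw [expY, ← seriesY_mul]
  refine timeSeries_ext fun α k => ?_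
  rw [timeCoeff_opX, map_add, map_smul, timeCoeff_seriesY le_rfl, timeCoeff_seriesY le_rfl,
    timeCoeff_seriesY le_rfl, Finset.mul_sum, Finset.smul_sum, ← Finset.sum_add_distrib]
  refine Finset.sum_congr rfl fun n _ => ?_
  rw [opX_eq_degreeScale, ← degreeScale_linY_pow (f := fun d => -((d + n * D : ℕ) : ℂ))
    fun d => rfl, timeCoeff_degreeScale, mul_comm _ PowerSeries.X]
  cases n with
  | zero => simp
  | succ n =>
    -- The power `Ŷ^(n+1)` shifts the eigenvalue of `X̂` by `(n+1) D`, and `(n+1) a^(n+1) / (n+1)! =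
    -- a * (a^n / n!)` is the matching coefficient of `a Ŷ e^{aŶ}`.
    rw [PowerSeries.coeff_succ_X_mul]
    simp only [PowerSeries.coeff_rescale, PowerSeries.coeff_exp, smul_eq_mul, Nat.factorial_succ]
    have h1 : (n.factorial : ℂ) ≠ 0 := by exact_mod_cast n.factorial_ne_zero
    have h2 : (n : ℂ) + 1 ≠ 0 := by exact_mod_cast n.succ_ne_zero
    push_cast
    simp
    field_simp
    ring

theorem opX_opY_commutator (F : TimeSeries D) :
    opX (opY N κ F) - opY N κ (opX F) = (D : ℂ) • opY N κ F := by
  have h := degreeScale_linY_pow (N := N) (κ := κ) (n := 1)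
    (f := fun d => -((d + 1 * D : ℕ) : ℂ)) (g := fun d => -(d : ℂ)) (fun d => rfl) F
  rw [pow_one, ← opX_eq_degreeScale] at h
  rw [opY_eq_linY, ← h]
  refine timeSeries_ext fun α k => ?_
  simp
  ring

/-! ### The operator `Ô` is conjugate to `X̂` -/

/-- `1 / (1 - e^{-D})`. -/
def conjFactor (D : ℕ) : ℝ := (1 - Real.exp (-(D : ℝ)))⁻¹

theorem one_sub_exp_neg_ne_zero (hD : 1 ≤ D) : 1 - Real.exp (-(D : ℝ)) ≠ 0 := by
  have : Real.exp (-(D : ℝ)) < 1 := Real.exp_lt_one_iff.2 (by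
    have : (0 : ℝ) < D := by exact_mod_cast hD
    linarith)
  linarith

theorem opO_eq (hD : 1 ≤ D) (F : TimeSeries D) :
    opO N κ F = opX F + (((D : ℝ) / (1 - Real.exp (-(D : ℝ))) : ℝ) : ℂ) • opY N κ F := by
  rw [opO]
  congr 3
  have h := one_sub_exp_neg_ne_zero hD
  have h1 : Real.exp (-(D : ℝ)) = Real.exp (-((D : ℝ) / 2)) * Real.exp (-((D : ℝ) / 2)) := by
    rw [← Real.exp_add]
    ring_nf
  have h2 : Real.exp ((D : ℝ) / 2) * Real.exp (-((D : ℝ) / 2)) = 1 := by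
    rw [← Real.exp_add]
    simp
  have h3 : Real.sinh ((D : ℝ) / 2) =
      Real.exp ((D : ℝ) / 2) * (1 - Real.exp (-(D : ℝ))) / 2 := by
    rw [Real.sinh_eq, h1, mul_sub, ← mul_assoc, h2]
    ring
  have h4 := (Real.exp_pos ((D : ℝ) / 2)).ne'
  rw [h3]
  field_simp

/-- Conjugating `X̂` by `e^{cŶ}` adds `c D Ŷ`, so the coefficient `D / (1 - e^{-D})` of `Ŷ` in `Ô`
dictates `c`. -/
theorem opO_eq_conj (hD : 1 ≤ D) (F : TimeSeries D) :
    opO N κ F = expY N κ (-conjFactor D : ℂ) (opX (expY N κ (conjFactor D) F)) := by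
  rw [opX_expY, expY_neg_expY, opO_eq hD, opY_eq_linY, conjFactor]
  congr 2
  push_cast
  rw [div_eq_mul_inv, mul_comm]

/-- Moving `e^X̂` to the right turns the two sides into `e^{e^D Ŷ} e^X̂` and `e^{c(e^D - 1)Ŷ} e^X̂`;
the same `c` solves `c (e^D - 1) = e^D`. -/
theorem opExp_opX_opExp_opY_eq_conj (hD : 1 ≤ D) (F : TimeSeries D) :
    opExp opX (opExp (opY N κ) F) = expY N κ (-conjFactor D : ℂ)
      (degreeScale (fun d => Complex.exp (-(d : ℂ))) (expY N κ (conjFactor D) F)) := by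
  rw [opExp_opX, opExp_opY, degreeScale_exp_expY, degreeScale_exp_expY, ← expY_add]
  congr 1
  have h : (1 : ℂ) - Complex.exp (-(D : ℂ)) ≠ 0 := by
    have := Complex.ofReal_ne_zero.2 (one_sub_exp_neg_ne_zero hD)
    push_cast at this
    exact this
  have h1 : Complex.exp (D : ℂ) * Complex.exp (-(D : ℂ)) = 1 := by
    rw [← Complex.exp_add]
    simp
  rw [conjFactor]
  push_cast
  congr 1
  field_simp
  linear_combination -h1

theorem iterate_conj {A B : TimeSeries D → TimeSeries D} {a : ℂ}
    (h : ∀ F, A F = expY N κ (-a) (B (expY N κ a F))) (n : ℕ) (F : TimeSeries D) :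
    A^[n] F = expY N κ (-a) (B^[n] (expY N κ a F)) := by
  induction n with
  | zero => simp [expY_neg_expY]
  | succ n ih => rw [Function.iterate_succ_apply', ih, h, expY_expY_neg,
      Function.iterate_succ_apply']

theorem hasSum_expTerm_opO (hD : 1 ≤ D) (F : TimeSeries D) :
    HasSum (expTerm (opO N κ) F) (opExp opX (opExp (opY N κ) F)) := by
  rw [opExp_opX_opExp_opY_eq_conj hD]
  refine HasSum.of_forall_eq ((hasSum_expTerm_opX _).seriesY _) fun n => ?_
  rw [expTerm, iterate_conj (opO_eq_conj hD), expTerm, map_smul]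
  rfl

theorem opExp_opO (hD : 1 ≤ D) (F : TimeSeries D) :
    opExp (opO N κ) F = opExp opX (opExp (opY N κ) F) :=
  HasSum.tsum_timeSeries (hasSum_expTerm_opO hD F)

theorem hasSum_logTerm (hD : 1 ≤ D) (F : TimeSeries D) :
    HasSum (logTerm (fun G => opExp opX (opExp (opY N κ) G)) F) (opO N κ F) := by
  rw [opO_eq_conj hD]
  refine HasSum.of_forall_eq ((hasSum_log_degreeScale _).seriesY _) fun n => ?_
  have h (G : TimeSeries D) : opExp opX (opExp (opY N κ) G) - G = expY N κ (-conjFactor D : ℂ)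
      (degreeScale (fun d => Complex.exp (-(d : ℂ)) - 1) (expY N κ (conjFactor D) G)) := by
    have : degreeScale (fun d => Complex.exp (-(d : ℂ)) - 1) (expY N κ (conjFactor D) G) =
        degreeScale (fun d => Complex.exp (-(d : ℂ))) (expY N κ (conjFactor D) G) -
          expY N κ (conjFactor D) G := timeSeries_ext fun α k => by simp; ring
    rw [this, map_sub, expY_neg_expY, opExp_opX_opExp_opY_eq_conj hD]
  rw [logTerm, iterate_conj h, map_smul]
  rfl

end OperatorY

/-! ### Generating series of the moments of a linear functional -/

section Source

variable {D N : ℕ} {κ : ℝ} {R : Type*} [CommRing R] [Algebra ℂ R]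

/-- `∏ y_v ^ (α v) / (α v)!`. -/
def dividedMonomial (y : Fin D × ℕ → R) (α : Fin D × ℕ →₀ ℕ) : R :=
  α.prod fun v k => ((k.factorial : ℂ)⁻¹) • y v ^ k

theorem dividedMonomial_add_single (y : Fin D × ℕ → R) (α : Fin D × ℕ →₀ ℕ) (v : Fin D × ℕ) :
    ((α v : ℂ) + 1) • dividedMonomial y (α + Finsupp.single v 1) = dividedMonomial y α * y v := by
  classical
  have h0 (v : Fin D × ℕ) : (((0 : ℕ).factorial : ℂ)⁻¹) • y v ^ 0 = 1 := by simp
  have hs : (α + Finsupp.single v 1).support ⊆ insert v α.support := by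
    intro w hw
    by_contra h
    simp only [Finset.mem_insert, not_or, Finsupp.mem_support_iff, not_not] at h
    simp [h.2, Ne.symm h.1] at hw
  rw [dividedMonomial, dividedMonomial, Finsupp.prod_of_support_subset _ hs _ fun i _ => h0 i,
    Finsupp.prod_of_support_subset _ (Finset.subset_insert v α.support) _ fun i _ => h0 i,
    ← Finset.mul_prod_erase _ _ (Finset.mem_insert_self v α.support),
    ← Finset.mul_prod_erase _ _ (Finset.mem_insert_self v α.support)]
  have : ∏ x ∈ (insert v α.support).erase v, ((((α + Finsupp.single v 1 : Fin D × ℕ →₀ ℕ) x).factorial : ℂ)⁻¹) •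
      y x ^ (α + Finsupp.single v 1 : Fin D × ℕ →₀ ℕ) x =
      ∏ x ∈ (insert v α.support).erase v, (((α x).factorial : ℂ)⁻¹) • y x ^ α x :=
    Finset.prod_congr rfl fun x hx => by
      simp [(Finset.ne_of_mem_erase hx).symm]
  rw [this, smul_mul_assoc, smul_smul]
  have h1 : ((α v).factorial : ℂ) ≠ 0 := by exact_mod_cast (α v).factorial_ne_zero
  have h2 : (α v : ℂ) + 1 ≠ 0 := by exact_mod_cast (α v).succ_ne_zero
  simp only [Finsupp.add_apply, Finsupp.single_eq_same, Nat.factorial_succ, pow_succ]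
  push_cast
  rw [mul_inv, mul_inv_cancel_left₀ h2, smul_mul_assoc]
  simp only [smul_mul_assoc]
  congr 1
  ring

/-- The series `∑_α L (y ^ α / α! * G) t ^ α`. -/
def sourceSeries (L : R →ₗ[ℂ] ℂ) (y : Fin D × ℕ → R) (G : R⟦X⟧) : TimeSeries D :=
  ofCoeffs fun α k => L (dividedMonomial y α * PowerSeries.coeff k G)

@[simp] theorem timeCoeff_sourceSeries (L : R →ₗ[ℂ] ℂ) (y : Fin D × ℕ → R) (G : R⟦X⟧)
    (α : Fin D × ℕ →₀ ℕ) (k : ℕ) : timeCoeff α k (sourceSeries L y G) =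
      L (dividedMonomial y α * PowerSeries.coeff k G) :=
  timeCoeff_ofCoeffs _ _ _

theorem timeCoeff_pderiv (F : TimeSeries D) (v : Fin D × ℕ) (α : Fin D × ℕ →₀ ℕ) (k : ℕ) :
    timeCoeff α k (MvPowerSeries.pderiv ℂ⟦X⟧ v F) =
      ((α v : ℂ) + 1) * timeCoeff (α + Finsupp.single v 1) k F := by
  have : ((α v : ℕ) : ℂ⟦X⟧) + 1 = PowerSeries.C ((α v : ℂ) + 1) := by simp
  rw [timeCoeff_apply, MvPowerSeries.coeff_pderiv, this, mul_comm, PowerSeries.coeff_C_mul,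
    timeCoeff_apply]

/-- The source series is formally `L (exp (∑ t_v y_v) G)`, so a derivative in `t_v` brings down a
factor `y_v`. -/
theorem pderiv_sourceSeries (L : R →ₗ[ℂ] ℂ) (y : Fin D × ℕ → R) (G : R⟦X⟧) (v : Fin D × ℕ) :
    MvPowerSeries.pderiv ℂ⟦X⟧ v (sourceSeries L y G) =
      sourceSeries L y (PowerSeries.C (y v) * G) := by
  refine timeSeries_ext fun α k => ?_
  rw [timeCoeff_pderiv, timeCoeff_sourceSeries, timeCoeff_sourceSeries, ← smul_eq_mul,
    ← map_smul, ← smul_mul_assoc, dividedMonomial_add_single, PowerSeries.coeff_C_mul, mul_assoc]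

theorem mixedDeriv_sourceSeries (L : R →ₗ[ℂ] ℂ) (y : Fin D × ℕ → R) (G : R⟦X⟧)
    (q : Fin D → ℕ) :
    mixedDeriv q (sourceSeries L y G) =
      sourceSeries L y (PowerSeries.C (∏ i, y (i, q i)) * G) := by
  rw [mixedDeriv, ← List.prod_ofFn, List.ofFn_eq_map]
  generalize List.finRange D = l
  induction l with
  | nil => simp
  | cons i l ih =>
    rw [List.foldr_cons, ih, pderiv_sourceSeries, List.map_cons, List.prod_cons, map_mul, mul_assoc]

/-- The series by which `Ŷ` multiplies the integrand of a moment generating series. -/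
def symbolY (N : ℕ) (κ : ℝ) (y : Fin D × ℕ → R) : R⟦X⟧ :=
  PowerSeries.mk fun k => ∑ q ∈ boundedExponents D k,
    if k = ∑ i, q.1 i then scalarY D N κ q.1 • ∏ i, y (i, q.1 i) else 0

theorem coeff_symbolY_mul (y : Fin D × ℕ → R) (G : R⟦X⟧) (k : ℕ) :
    PowerSeries.coeff k (symbolY N κ y * G) = ∑ q ∈ boundedExponents D k,
      scalarY D N κ q.1 • (∏ i, y (i, q.1 i)) * PowerSeries.coeff (k - ∑ i, q.1 i) G := by
  have h : PowerSeries.coeff k (symbolY N κ y * G) = PowerSeries.coeff k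
      ((∑ q ∈ boundedExponents D k, PowerSeries.X ^ (∑ i, q.1 i) *
        PowerSeries.C (scalarY D N κ q.1 • ∏ i, y (i, q.1 i))) * G) := by
    rw [PowerSeries.coeff_mul, PowerSeries.coeff_mul]
    refine Finset.sum_congr rfl fun p hp => ?_
    have hpk := Finset.HasAntidiagonal.mem_antidiagonal.1 hp
    congr 1
    rw [symbolY, PowerSeries.coeff_mk, map_sum]
    simp only [PowerSeries.coeff_mul_C, PowerSeries.coeff_X_pow, ite_mul, one_mul, zero_mul]
    refine Finset.sum_subset (fun q hq => ?_) fun q _ hq => ?_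
    · rw [mem_boundedExponents] at hq ⊢
      omega
    · rw [mem_boundedExponents] at hq
      rw [if_neg (by omega)]
  rw [h, Finset.sum_mul, map_sum]
  refine Finset.sum_congr rfl fun q hq => ?_
  rw [mul_assoc, PowerSeries.coeff_X_pow_mul', if_pos (mem_boundedExponents.1 hq),
    PowerSeries.coeff_C_mul]

theorem linY_sourceSeries (L : R →ₗ[ℂ] ℂ) (y : Fin D × ℕ → R) (G : R⟦X⟧) :
    linY D N κ (sourceSeries L y G) = sourceSeries L y (symbolY N κ y * G) := by
  refine timeSeries_ext fun α k => ?_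
  have h (q : {q : Fin D → ℕ // q ≠ 0}) (hq : q ∈ boundedExponents D k) :
      scalarY D N κ q.1 * mixedDerivFactor q.1 α *
        timeCoeff (α + timeExponent q.1) (k - ∑ i, q.1 i) (sourceSeries L y G) =
      L (dividedMonomial y α * (scalarY D N κ q.1 • (∏ i, y (i, q.1 i)) *
        PowerSeries.coeff (k - ∑ i, q.1 i) G)) := by
    -- Computing the mixed derivative in two ways eliminates the unspecified integer factor.
    have h1 := congrArg (PowerSeries.coeff (k - ∑ i, q.1 i))
      (coeff_mixedDeriv q.1 α (sourceSeries L y G))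
    rw [mixedDeriv_sourceSeries, ← timeCoeff_apply, timeCoeff_sourceSeries,
      PowerSeries.coeff_C_mul, ← map_natCast (PowerSeries.C (R := ℂ)), PowerSeries.coeff_C_mul,
      ← timeCoeff_apply] at h1
    rw [mul_assoc, ← h1, ← smul_eq_mul, ← map_smul, smul_mul_assoc, mul_smul_comm]
  rw [timeCoeff_linY, Finset.sum_congr rfl h, ← map_sum, ← Finset.mul_sum, timeCoeff_sourceSeries,
    coeff_symbolY_mul]

theorem linY_pow_sourceSeries (L : R →ₗ[ℂ] ℂ) (y : Fin D × ℕ → R) (n : ℕ) :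
    (linY D N κ ^ n) (sourceSeries L y 1) = sourceSeries L y (symbolY N κ y ^ n) := by
  induction n with
  | zero => simp
  | succ n ih => rw [pow_succ', Module.End.mul_apply, ih, linY_sourceSeries, pow_succ']

/-- At `t = 0` the operator `e^X̂` has eigenvalue `1`, and `e^Ŷ` leaves the functional applied to
the exponential of the symbol, cut off at order `k`. -/
theorem coeff_constantCoeff_opExp_sourceSeries (L : R →ₗ[ℂ] ℂ) (y : Fin D × ℕ → R) (k : ℕ) :
    PowerSeries.coeff k (MvPowerSeries.constantCoeff
      (opExp opX (opExp (opY N κ) (sourceSeries L y 1)))) =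
      L (∑ n ∈ Finset.range (k + 1),
        ((n.factorial : ℂ)⁻¹) • PowerSeries.coeff k (symbolY N κ y ^ n)) := by
  rw [← MvPowerSeries.coeff_zero_eq_constantCoeff_apply, ← timeCoeff_apply, opExp_opX,
    timeCoeff_degreeScale, opExp_opY, expY, timeCoeff_seriesY le_rfl, map_sum, Finset.mul_sum]
  refine Finset.sum_congr rfl fun n _ => ?_
  rw [linY_pow_sourceSeries]
  simp [dividedMonomial]

end Source

/-! ### Coefficients of the product of one-matrix models -/

section Product

variable {D : ℕ}

/-- The exponents of the times `t^i_p` for a fixed `i`. -/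
def colorExponent (α : Fin D × ℕ →₀ ℕ) (i : Fin D) : ℕ →₀ ℕ :=
  α.comapDomain (Function.Embedding.sectR i ℕ) (Function.Embedding.injective _).injOn

@[simp] theorem colorExponent_apply (α : Fin D × ℕ →₀ ℕ) (i : Fin D) (p : ℕ) :
    colorExponent α i p = α (i, p) := rfl

theorem embDomain_sectR_apply (i j : Fin D) (x : ℕ →₀ ℕ) (p : ℕ) :
    Finsupp.embDomain (Function.Embedding.sectR i ℕ) x (j, p) = if j = i then x p else 0 := by
  split_ifs with h
  · subst h
    exact Finsupp.embDomain_apply_self (Function.Embedding.sectR j ℕ) x p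
  · refine Finsupp.embDomain_of_notMem_range _ _ _ ?_
    rintro ⟨r, hr⟩
    exact h (congrArg Prod.fst hr).symm

/-- The factors involve disjoint sets of variables, so only one way of distributing `α` among them
contributes. -/
theorem coeff_prod_rename_sectR {A : Type*} [CommSemiring A] (f : Fin D → MvPowerSeries ℕ A)
    (α : Fin D × ℕ →₀ ℕ) :
    MvPowerSeries.coeff α (∏ i, MvPowerSeries.rename (Function.Embedding.sectR i ℕ) (f i)) =
      ∏ i, MvPowerSeries.coeff (colorExponent α i) (f i) := by
  classical
  rw [MvPowerSeries.coeff_prod]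
  rw [Finset.sum_eq_single (Finsupp.equivFunOnFinite.symm fun i =>
    Finsupp.embDomain (Function.Embedding.sectR i ℕ) (colorExponent α i))]
  · simp [MvPowerSeries.coeff_embDomain_rename]
  · intro l hl hne
    by_contra h0
    have hr (i : Fin D) : ∃ x, Finsupp.embDomain (Function.Embedding.sectR i ℕ) x = l i := by
      by_contra hx
      refine h0 (Finset.prod_eq_zero (Finset.mem_univ i) ?_)
      exact MvPowerSeries.coeff_rename_eq_zero _ _ (by
        simpa [Finsupp.embDomain_eq_mapDomain] using hx)
    choose x hx using hr
    refine hne (Finsupp.ext fun i => ?_)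
    rw [Finsupp.equivFunOnFinite_symm_apply_apply, ← hx]
    congr 1
    ext p
    have hs := (Finset.mem_finsuppAntidiag.1 hl).1
    rw [colorExponent_apply, ← hs, Finsupp.finsetSum_apply]
    simp_rw [← hx, embDomain_sectR_apply]
    simp
  · intro h
    exfalso
    refine h (Finset.mem_finsuppAntidiag.2 ⟨?_, Finset.subset_univ _⟩)
    ext ⟨j, p⟩
    simp [Finsupp.finsetSum_apply, embDomain_sectR_apply]

theorem prod_eq_prod_colorExponent {A : Type*} [CommMonoid A] (g : Fin D × ℕ → ℕ → A)
    (hg : ∀ v, g v 0 = 1) (α : Fin D × ℕ →₀ ℕ) :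
    α.prod g = ∏ i, (colorExponent α i).prod fun p => g (i, p) := by
  classical
  rw [Finsupp.prod_of_support_subset α (s := Finset.univ ×ˢ α.support.image Prod.snd)
    (fun v hv => Finset.mem_product.2 ⟨Finset.mem_univ _, Finset.mem_image_of_mem _ hv⟩) _
    fun v _ => hg v, Finset.prod_product]
  refine Finset.prod_congr rfl fun i _ => ?_
  rw [Finsupp.prod_of_support_subset (colorExponent α i) (s := α.support.image Prod.snd)
    (fun p hp => Finset.mem_image.2 ⟨(i, p), by simpa using hp, rfl⟩) _ fun p _ => hg (i, p)]
  rfl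

theorem timeCoeff_matrixProduct (N : ℕ) (α : Fin D × ℕ →₀ ℕ) (k : ℕ) :
    timeCoeff α k (matrixProduct D N) =
      if k = 0 then ∏ i, oneMatrixPartition N (colorExponent α i) else 0 := by
  rw [timeCoeff_apply, matrixProduct, coeff_prod_rename_sectR]
  simp only [MvPowerSeries.coeff_map]
  rw [← map_prod, PowerSeries.coeff_C]
  rfl

theorem matrixProduct_eq_sourceSeries {R : Type*} [CommRing R] [Algebra ℂ R] (N : ℕ)
    (L : R →ₗ[ℂ] ℂ) (y : Fin D × ℕ → R)
    (h : ∀ α : Fin D → ℕ →₀ ℕ, L (∏ i, (α i).prod fun p k => ((k.factorial : ℂ)⁻¹) • y (i, p) ^ k)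
      = ∏ i, oneMatrixPartition N (α i)) :
    matrixProduct D N = sourceSeries L y 1 := by
  refine timeSeries_ext fun α k => ?_
  rw [timeCoeff_matrixProduct, timeCoeff_sourceSeries, PowerSeries.coeff_one, dividedMonomial,
    prod_eq_prod_colorExponent _ (fun v => by simp), ← h]
  split_ifs <;> simp

end Product

/-! ### Exponentials of formal power series -/

theorem coeff_exp_subst {W : ℂ⟦X⟧} (hW : PowerSeries.constantCoeff W = 0) (k : ℕ) :
    PowerSeries.coeff k ((PowerSeries.exp ℂ).subst W) = ∑ n ∈ Finset.range (k + 1),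
      ((n.factorial : ℂ)⁻¹) * PowerSeries.coeff k (W ^ n) := by
  rw [PowerSeries.coeff_subst' (PowerSeries.HasSubst.of_constantCoeff_zero' hW),
    finsum_eq_sum_of_support_subset (s := Finset.range (k + 1))]
  · simp [PowerSeries.coeff_exp]
  · intro n hn
    by_contra h
    refine hn ?_
    have : PowerSeries.coeff k (W ^ n) = 0 := by
      refine PowerSeries.coeff_of_lt_order k ?_
      refine lt_of_lt_of_le ?_ (PowerSeries.le_order_pow_of_constantCoeff_eq_zero n hW)
      simpa using h
    simp [this]

/-- A first-order linear differential equation determines each coefficient from the earlier ones, as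
`n + 1` is invertible. -/
theorem eq_of_derivative_eq_mul {f g V : ℂ⟦X⟧} (hf : PowerSeries.derivative ℂ f = V * f)
    (hg : PowerSeries.derivative ℂ g = V * g)
    (h : PowerSeries.constantCoeff f = PowerSeries.constantCoeff g) : f = g := by
  ext n
  induction n using Nat.strong_induction_on with
  | _ n ih =>
    cases n with
    | zero => simpa using h
    | succ n =>
      have h1 := congrArg (PowerSeries.coeff n) hf
      have h2 := congrArg (PowerSeries.coeff n) hg
      rw [PowerSeries.coeff_derivative, PowerSeries.coeff_mul] at h1 h2
      have h3 : ∑ p ∈ Finset.HasAntidiagonal.antidiagonal n, PowerSeries.coeff p.1 V * PowerSeries.coeff p.2 f =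
          ∑ p ∈ Finset.HasAntidiagonal.antidiagonal n, PowerSeries.coeff p.1 V * PowerSeries.coeff p.2 g :=
        Finset.sum_congr rfl fun p hp => by
          rw [ih p.2 (by
            have := Finset.HasAntidiagonal.mem_antidiagonal.1 hp
            omega)]
      rw [h3, ← h2] at h1
      exact mul_right_cancel₀ (by exact_mod_cast n.succ_ne_zero) h1

theorem derivative_mk_pow (a : ℂ) :
    PowerSeries.derivative ℂ (PowerSeries.mk fun n => a ^ n) =
      (PowerSeries.mk fun n => a ^ (n + 1)) * PowerSeries.mk fun n => a ^ n := by
  ext n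
  rw [PowerSeries.coeff_derivative, PowerSeries.coeff_mul, PowerSeries.coeff_mk]
  have : ∀ p ∈ Finset.HasAntidiagonal.antidiagonal n, PowerSeries.coeff p.1 (PowerSeries.mk fun n => a ^ (n + 1)) *
      PowerSeries.coeff p.2 (PowerSeries.mk fun n => a ^ n) = a ^ (n + 1) := fun p hp => by
    have := Finset.HasAntidiagonal.mem_antidiagonal.1 hp
    rw [PowerSeries.coeff_mk, PowerSeries.coeff_mk, ← pow_add]
    congr 1
    omega
  rw [Finset.sum_congr rfl this]
  simp [mul_comm]

/-- `exp (∑_j ∑_{k ≥ 1} (a_j z) ^ k / k) = ∏_j 1 / (1 - a_j z)`. -/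
theorem exp_subst_sum_log {J : Type*} [Fintype J] (a : J → ℂ) {W : ℂ⟦X⟧}
    (hW : W = PowerSeries.mk fun k => (∑ j, a j ^ k) / k) :
    (PowerSeries.exp ℂ).subst W = ∏ j, PowerSeries.mk fun n => a j ^ n := by
  classical
  have h0 : PowerSeries.constantCoeff W = 0 := by
    -- The coefficient at `k = 0` is a division by zero, hence `0`.
    rw [hW, ← PowerSeries.coeff_zero_eq_constantCoeff_apply]
    simp
  have hs := PowerSeries.HasSubst.of_constantCoeff_zero' h0
  -- Both sides have constant term `1` and logarithmic derivative `W' = ∑_j a_j / (1 - a_j z)`.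
  refine eq_of_derivative_eq_mul (V := PowerSeries.derivative ℂ W) ?_ ?_ ?_
  · rw [PowerSeries.derivative_subst hs, PowerSeries.derivative_exp, mul_comm]
  · have hd : PowerSeries.derivative ℂ W = ∑ j, PowerSeries.mk fun n => a j ^ (n + 1) := by
      ext n
      rw [PowerSeries.coeff_derivative, hW, PowerSeries.coeff_mk, map_sum]
      have : (n : ℂ) + 1 ≠ 0 := by exact_mod_cast n.succ_ne_zero
      push_cast
      simp
      field_simp
    rw [hd]
    induction (Finset.univ : Finset J) using Finset.induction_on with
    | empty => simp
    | insert j s hj ih =>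
      rw [Finset.prod_insert hj, Finset.sum_insert hj, Derivation.leibniz, ih, derivative_mk_pow,
        smul_eq_mul, smul_eq_mul]
      ring
  · rw [← PowerSeries.coeff_zero_eq_constantCoeff_apply, coeff_exp_subst h0, map_prod]
    simp only [← PowerSeries.coeff_zero_eq_constantCoeff_apply, PowerSeries.coeff_mk]
    simp

open MeasureTheory

/-! ### Moments of Gaussian measures -/

theorem rescale_sum_exp {V : Type*} (s : Finset V) (a : V → ℂ) :
    PowerSeries.rescale (∑ v ∈ s, a v) (PowerSeries.exp ℂ) =
      ∏ v ∈ s, PowerSeries.rescale (a v) (PowerSeries.exp ℂ) := by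
  classical
  induction s using Finset.induction_on with
  | empty => simp [PowerSeries.rescale_zero]
  | insert v s hv ih =>
    rw [Finset.sum_insert hv, Finset.prod_insert hv, ← ih, PowerSeries.exp_mul_exp_eq_exp_add]

theorem coeff_rescale_exp (a : ℂ) (n : ℕ) :
    PowerSeries.coeff n (PowerSeries.rescale a (PowerSeries.exp ℂ)) = a ^ n / n.factorial := by
  rw [PowerSeries.coeff_rescale, PowerSeries.coeff_exp]
  simp [div_eq_mul_inv]

/-- If the moments of independent variables factorise, then so does the moment generating series of
a linear form. -/
theorem mk_integral_linearForm {Ω V : Type*} [MeasurableSpace Ω] [Fintype V] {μ : Measure Ω}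
    {w : Ω → ℂ} {Z : ℂ} {x : V → Ω → ℂ} {m : V → ℕ → ℂ}
    (hint : ∀ α : V → ℕ, Integrable (fun ω => (∏ v, x v ω ^ α v) * w ω) μ)
    (hm : ∀ α : V → ℕ, (∫ ω, (∏ v, x v ω ^ α v) * w ω ∂μ) / Z = ∏ v, m v (α v)) (c : V → ℂ) :
    PowerSeries.mk (fun n =>
      (∫ ω, (∑ v, c v * x v ω) ^ n / (n.factorial : ℂ) * w ω ∂μ) / Z) =
      ∏ v, PowerSeries.mk fun k => c v ^ k * m v k / k.factorial := by
  classical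
  ext n
  rw [PowerSeries.coeff_mk, PowerSeries.coeff_prod]
  have h (ω : Ω) : (∑ v, c v * x v ω) ^ n / (n.factorial : ℂ) * w ω =
      ∑ l ∈ Finset.univ.finsuppAntidiag n, (∏ v, c v ^ l v / (l v).factorial) *
        ((∏ v, x v ω ^ l v) * w ω) := by
    -- The multinomial theorem, in the form `exp (∑ u_v) = ∏ exp u_v`.
    rw [← coeff_rescale_exp, rescale_sum_exp, PowerSeries.coeff_prod, Finset.sum_mul]
    refine Finset.sum_congr rfl fun l _ => ?_
    rw [← mul_assoc, ← Finset.prod_mul_distrib]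
    congr 1
    refine Finset.prod_congr rfl fun v _ => ?_
    rw [coeff_rescale_exp]
    ring
  simp_rw [h]
  rw [integral_finsetSum _ fun (l : V →₀ ℕ) _ => (hint l).const_mul _, Finset.sum_div]
  refine Finset.sum_congr rfl fun l _ => ?_
  rw [integral_const_mul, mul_div_assoc, hm, ← Finset.prod_mul_distrib]
  refine Finset.prod_congr rfl fun v _ => ?_
  rw [PowerSeries.coeff_mk]
  ring

theorem integrable_pow_mul_exp_neg_sq {b : ℝ} (hb : 0 < b) (k : ℕ) :
    Integrable fun x : ℝ => x ^ k * Real.exp (-b * x ^ 2) := by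
  have : (-1 : ℝ) < k := by
    have : (0 : ℝ) ≤ k := k.cast_nonneg
    linarith
  simpa using integrable_rpow_mul_exp_neg_mul_sq hb this

theorem hasDerivAt_exp_neg_sq (b x : ℝ) :
    HasDerivAt (fun x : ℝ => Real.exp (-b * x ^ 2)) (-(2 * b * x) * Real.exp (-b * x ^ 2)) x := by
  have h := ((hasDerivAt_pow 2 x).const_mul (-b)).exp
  refine h.congr_deriv ?_
  simp
  ring

theorem integral_pow_mul_exp_neg_sq_one {b : ℝ} (hb : 0 < b) :
    ∫ x : ℝ, x ^ 1 * Real.exp (-b * x ^ 2) = 0 := by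
  have h := integral_eq_zero_of_hasDerivAt_of_integrable (hasDerivAt_exp_neg_sq b)
    (by
      refine ((integrable_pow_mul_exp_neg_sq hb 1).const_mul (-(2 * b))).congr
        (Filter.Eventually.of_forall fun x => ?_)
      simp only
      ring)
    (by simpa using integrable_pow_mul_exp_neg_sq hb 0)
  have h1 : ∫ x : ℝ, -(2 * b * x) * Real.exp (-b * x ^ 2) =
      -(2 * b) * ∫ x : ℝ, x ^ 1 * Real.exp (-b * x ^ 2) := by
    rw [← integral_const_mul]
    congr 1
    funext x
    ring
  rw [h1] at h
  rcases mul_eq_zero.1 h with h | h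
  · linarith
  · exact h

/-- Integration by parts: the derivative of `x^(k+1) e^{-b x²}` has integral zero. -/
theorem integral_pow_mul_exp_neg_sq_add_two {b : ℝ} (hb : 0 < b) (k : ℕ) :
    2 * b * ∫ x : ℝ, x ^ (k + 2) * Real.exp (-b * x ^ 2) =
      (k + 1) * ∫ x : ℝ, x ^ k * Real.exp (-b * x ^ 2) := by
  have hd (x : ℝ) : HasDerivAt (fun x : ℝ => x ^ (k + 1) * Real.exp (-b * x ^ 2))
      ((k + 1) * (x ^ k * Real.exp (-b * x ^ 2)) -
        2 * b * (x ^ (k + 2) * Real.exp (-b * x ^ 2))) x := by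
    refine ((hasDerivAt_pow (k + 1) x).mul (hasDerivAt_exp_neg_sq b x)).congr_deriv ?_
    simp
    ring
  have hi := (integrable_pow_mul_exp_neg_sq hb k).const_mul ((k : ℝ) + 1)
  have hi2 := (integrable_pow_mul_exp_neg_sq hb (k + 2)).const_mul (2 * b)
  have h := integral_eq_zero_of_hasDerivAt_of_integrable hd (hi.sub hi2)
    (integrable_pow_mul_exp_neg_sq hb (k + 1))
  rw [integral_sub hi hi2, integral_const_mul, integral_const_mul, sub_eq_zero] at h
  exact h.symm

theorem integral_exp_neg_sq_ne_zero {b : ℝ} (hb : 0 < b) :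
    ∫ x : ℝ, Real.exp (-b * x ^ 2) ≠ 0 := by
  rw [integral_gaussian]
  exact (Real.sqrt_pos.2 (div_pos Real.pi_pos hb)).ne'

/-- The moments of a normalised Gaussian measure on the line. -/
def gaussianMoment (b : ℝ) (k : ℕ) : ℂ :=
  (∫ x : ℝ, (x : ℂ) ^ k * (Real.exp (-b * x ^ 2) : ℂ)) / (∫ x : ℝ, (Real.exp (-b * x ^ 2) : ℂ))

theorem gaussianMoment_eq (b : ℝ) (k : ℕ) : gaussianMoment b k =
    (((∫ x : ℝ, x ^ k * Real.exp (-b * x ^ 2)) / ∫ x : ℝ, Real.exp (-b * x ^ 2) : ℝ) : ℂ) := by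
  rw [gaussianMoment, Complex.ofReal_div, ← integral_complex_ofReal, ← integral_complex_ofReal]
  simp only [Complex.ofReal_mul, Complex.ofReal_pow]

theorem gaussianMoment_zero {b : ℝ} (hb : 0 < b) : gaussianMoment b 0 = 1 := by
  rw [gaussianMoment_eq]
  simp only [pow_zero, one_mul, div_self (integral_exp_neg_sq_ne_zero hb), Complex.ofReal_one]

theorem gaussianMoment_one {b : ℝ} (hb : 0 < b) : gaussianMoment b 1 = 0 := by
  rw [gaussianMoment_eq, integral_pow_mul_exp_neg_sq_one hb]
  simp

theorem gaussianMoment_add_two {b : ℝ} (hb : 0 < b) (k : ℕ) :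
    2 * b * gaussianMoment b (k + 2) = (k + 1) * gaussianMoment b k := by
  rw [gaussianMoment_eq, gaussianMoment_eq]
  have := integral_pow_mul_exp_neg_sq_add_two hb k
  norm_cast
  rw [← mul_div_assoc, this, mul_div_assoc]
  norm_cast

/-- This is `E[e^{cx}] = e^{c²/(4b)}` as formal series. Odd moments vanish, whence the substitution
of a square, and the two-step recursion of the moments matches that of the coefficients. -/
theorem mk_gaussianMoment {b : ℝ} (hb : 0 < b) (c : ℂ) :
    (PowerSeries.mk fun k => c ^ k * gaussianMoment b k / k.factorial) =
      PowerSeries.expand 2 two_ne_zero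
        (PowerSeries.rescale (c ^ 2 / (4 * b)) (PowerSeries.exp ℂ)) := by
  have hb' : (b : ℂ) ≠ 0 := by exact_mod_cast hb.ne'
  ext k
  induction k using Nat.twoStepInduction with
  | zero =>
    rw [PowerSeries.coeff_expand, Nat.zero_div, coeff_rescale_exp]
    simp [gaussianMoment_zero hb]
  | one => simp [PowerSeries.coeff_expand, gaussianMoment_one hb]
  | more k ih _ =>
    rw [PowerSeries.coeff_expand] at ih ⊢
    rw [PowerSeries.coeff_mk] at ih ⊢
    have h := gaussianMoment_add_two hb k
    have h1 : gaussianMoment b (k + 2) = (k + 1) / (2 * b) * gaussianMoment b k := by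
      field_simp
      linear_combination h
    have h2 : ((k + 2).factorial : ℂ) = (k + 2) * (k + 1) * k.factorial := by
      rw [Nat.factorial_succ, Nat.factorial_succ]
      push_cast
      ring
    have h3 : (k.factorial : ℂ) ≠ 0 := by exact_mod_cast k.factorial_ne_zero
    have h4 : (k : ℂ) + 1 ≠ 0 := by exact_mod_cast k.succ_ne_zero
    have h5 : (k : ℂ) + 2 ≠ 0 := by exact_mod_cast (k + 1).succ_ne_zero
    have h6 : c ^ (k + 2) * gaussianMoment b (k + 2) / ((k + 2).factorial : ℂ) =
        c ^ 2 / (2 * b * (k + 2)) * (c ^ k * gaussianMoment b k / k.factorial) := by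
      rw [h1, h2]
      field_simp
      ring
    rw [h6, ih]
    by_cases hk : 2 ∣ k
    · obtain ⟨j, rfl⟩ := hk
      have hj : (j : ℂ) + 1 ≠ 0 := by exact_mod_cast j.succ_ne_zero
      have hj' : (j.factorial : ℂ) ≠ 0 := by exact_mod_cast j.factorial_ne_zero
      rw [if_pos (dvd_mul_right 2 j), if_pos (by omega), Nat.mul_div_cancel_left j two_pos,
        show (2 * j + 2) / 2 = j + 1 by omega, coeff_rescale_exp, coeff_rescale_exp,
        Nat.factorial_succ]
      push_cast at h5 ⊢
      rw [pow_succ _ j, show (2 * (j : ℂ) + 2) = 2 * (j + 1) by ring]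
      generalize (c ^ 2 / (4 * (b : ℂ))) ^ j = t
      field_simp
      ring
    · rw [if_neg hk, if_neg (by omega), mul_zero]

/-! ### Gaussian measures on complex vectors -/

section ComplexGaussian

variable {J : Type*} [Fintype J] {β : ℝ}

theorem integral_norm_pow_mul_exp (hβ : 0 < β) (k : ℕ) :
    ∫ z : ℂ, ‖z‖ ^ (2 * k) * Real.exp (-β * ‖z‖ ^ 2) =
      Real.pi * (β ^ (k + 1))⁻¹ * k.factorial := by
  have h2 : (-2 : ℝ) < ((2 * k : ℕ) : ℝ) := by
    have : (0 : ℝ) ≤ ((2 * k : ℕ) : ℝ) := Nat.cast_nonneg _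
    linarith
  have h := Complex.integral_rpow_mul_exp_neg_mul_rpow (p := 2) (by norm_num) h2 hβ
  simp only [Real.rpow_natCast, Real.rpow_two] at h
  rw [h]
  have h3 : (((2 * k : ℕ) : ℝ) + 2) / 2 = k + 1 := by
    push_cast
    ring
  rw [neg_div, h3, Real.Gamma_nat_eq_factorial, Real.rpow_neg hβ.le]
  have h4 : β ^ ((k : ℝ) + 1) = β ^ (k + 1) := by exact_mod_cast Real.rpow_natCast β (k + 1)
  rw [h4]
  ring

theorem integrable_norm_pow_mul_exp (hβ : 0 < β) (k : ℕ) :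
    Integrable fun z : ℂ => ‖z‖ ^ (2 * k) * Real.exp (-β * ‖z‖ ^ 2) := by
  -- A non-integrable function has integral `0` by convention, so the explicit nonzero value proves
  -- integrability.
  refine Integrable.of_integral_ne_zero ?_
  rw [integral_norm_pow_mul_exp hβ]
  have := k.factorial_ne_zero
  have := Real.pi_ne_zero
  positivity

theorem integrable_monomial_mul_exp (hβ : 0 < β) (k l : ℕ) :
    Integrable fun z : ℂ => z ^ k * star z ^ l * (Real.exp (-β * ‖z‖ ^ 2) : ℂ) := by
  refine Integrable.mono' ((integrable_norm_pow_mul_exp hβ k).add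
    (integrable_norm_pow_mul_exp hβ l)) (by fun_prop) (Filter.Eventually.of_forall fun z => ?_)
  have he := Real.exp_pos (-β * ‖z‖ ^ 2)
  simp only [norm_mul, norm_pow, norm_star, Complex.norm_real, Real.norm_eq_abs, abs_of_pos he,
    Pi.add_apply]
  rw [← add_mul]
  refine mul_le_mul_of_nonneg_right ?_ he.le
  nlinarith [sq_nonneg (‖z‖ ^ k - ‖z‖ ^ l), sq_nonneg (‖z‖ ^ k + ‖z‖ ^ l), pow_mul' ‖z‖ 2 k,
    pow_mul' ‖z‖ 2 l]

/-- The Gaussian weight on complex vectors. -/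
def vectorWeight (β : ℝ) (T : J → ℂ) : ℂ := ∏ n, (Real.exp (-β * ‖T n‖ ^ 2) : ℂ)

theorem integrable_monomial_mul_vectorWeight (hβ : 0 < β) (k l : J → ℕ) :
    Integrable fun T : J → ℂ =>
      (∏ n, (T n ^ k n * star (T n) ^ l n)) * vectorWeight β T := by
  simp only [vectorWeight, ← Finset.prod_mul_distrib]
  exact Integrable.fintype_prod fun n => integrable_monomial_mul_exp hβ (k n) (l n)

theorem integral_vectorWeight (hβ : 0 < β) :
    ∫ T : J → ℂ, vectorWeight β T = ∏ _n : J, (Real.pi * β⁻¹ : ℂ) := by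
  simp only [vectorWeight]
  rw [integral_fintype_prod_volume_eq_prod fun _ (z : ℂ) => (Real.exp (-β * ‖z‖ ^ 2) : ℂ)]
  refine Finset.prod_congr rfl fun n _ => ?_
  have := integral_norm_pow_mul_exp hβ 0
  simp only [mul_zero, pow_zero, one_mul] at this
  rw [integral_complex_ofReal, this]
  simp

theorem integral_vectorWeight_ne_zero (hβ : 0 < β) : ∫ T : J → ℂ, vectorWeight β T ≠ 0 := by
  rw [integral_vectorWeight hβ]
  have : (β : ℂ) ≠ 0 := by exact_mod_cast hβ.ne'
  have := Real.pi_ne_zero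
  exact Finset.prod_ne_zero_iff.2 fun _ _ => by simp [*]

/-- The variables `‖T n‖²` are independent and exponentially distributed with mean `1/β`. The `k!`
in their moments cancels the one in the exponential, which turns generating series into geometric
series. -/
theorem integral_prod_norm_mul_vectorWeight (hβ : 0 < β) (k : J → ℕ) :
    (∫ T : J → ℂ, (∏ n, (‖T n‖ ^ 2 : ℂ) ^ k n) * vectorWeight β T) /
      (∫ T : J → ℂ, vectorWeight β T) = ∏ n, ((k n).factorial : ℂ) * (β : ℂ)⁻¹ ^ k n := by
  rw [integral_vectorWeight hβ]
  simp only [vectorWeight, ← Finset.prod_mul_distrib]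
  rw [integral_fintype_prod_volume_eq_prod
    fun n (z : ℂ) => (‖z‖ ^ 2 : ℂ) ^ k n * (Real.exp (-β * ‖z‖ ^ 2) : ℂ), ← Finset.prod_div_distrib]
  refine Finset.prod_congr rfl fun n _ => ?_
  have h := integral_norm_pow_mul_exp hβ (k n)
  have h1 : ∫ z : ℂ, (‖z‖ ^ 2 : ℂ) ^ k n * (Real.exp (-β * ‖z‖ ^ 2) : ℂ) =
      ((∫ z : ℂ, ‖z‖ ^ (2 * k n) * Real.exp (-β * ‖z‖ ^ 2) : ℝ) : ℂ) := by
    rw [← integral_complex_ofReal]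
    simp only [Complex.ofReal_mul, Complex.ofReal_pow, pow_mul]
  have h2 : (β : ℂ) ≠ 0 := by exact_mod_cast hβ.ne'
  have h3 : (Real.pi : ℂ) ≠ 0 := by exact_mod_cast Real.pi_ne_zero
  rw [h1, h]
  push_cast
  rw [inv_pow, pow_succ]
  field_simp

/-- The generating series of the moments of a diagonal quadratic form. -/
theorem mk_integral_diagonal_form (hβ : 0 < β) (d : J → ℂ) :
    PowerSeries.mk (fun k => (∫ T : J → ℂ, (∑ n, d n * (‖T n‖ ^ 2 : ℂ)) ^ k / (k.factorial : ℂ) *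
      vectorWeight β T) / ∫ T : J → ℂ, vectorWeight β T) =
      ∏ n, PowerSeries.mk fun k => (d n * (β : ℂ)⁻¹) ^ k := by
  rw [mk_integral_linearForm (x := fun n (T : J → ℂ) => (‖T n‖ ^ 2 : ℂ))
    (m := fun _ k => (k.factorial : ℂ) * (β : ℂ)⁻¹ ^ k) (fun α => ?_)
    (integral_prod_norm_mul_vectorWeight hβ)]
  · refine Finset.prod_congr rfl fun n _ => ?_
    congr 1
    funext k
    have : (k.factorial : ℂ) ≠ 0 := by exact_mod_cast k.factorial_ne_zero
    rw [mul_pow]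
    field_simp
  · refine (integrable_monomial_mul_vectorWeight hβ α α).congr
      (Filter.Eventually.of_forall fun T => ?_)
    simp only
    congr 1
    refine Finset.prod_congr rfl fun n _ => ?_
    rw [← mul_pow]
    congr 1
    exact Complex.mul_conj' _

/-- Gaussian integrals are invariant under the linear maps that preserve the weight. -/
theorem integral_comp_mulVec_div {U U' : Matrix J J ℂ} [DecidableEq J] (h : U' * U = 1)
    (hw : ∀ T : J → ℂ, vectorWeight β (U.mulVec T) = vectorWeight β T) (hβ : 0 < β)
    (F : (J → ℂ) → ℂ) :
    (∫ T : J → ℂ, F T * vectorWeight β T) / (∫ T : J → ℂ, vectorWeight β T) =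
      (∫ T : J → ℂ, F (U.mulVec T) * vectorWeight β T) / (∫ T : J → ℂ, vectorWeight β T) := by
  have h' : U * U' = 1 := mul_eq_one_comm.1 h
  let e : (J → ℂ) ≃ₗ[ℝ] (J → ℂ) := (LinearEquiv.ofLinearMap U.mulVecLin U'.mulVecLin
    (by rw [← Matrix.mulVecLin_mul, h', Matrix.mulVecLin_one])
    (by rw [← Matrix.mulVecLin_mul, h, Matrix.mulVecLin_one])).restrictScalars ℝ
  have he (T : J → ℂ) : e T = U.mulVec T := rfl
  have hdet : LinearMap.det (e : (J → ℂ) →ₗ[ℝ] (J → ℂ)) ≠ 0 := e.isUnit_det'.ne_zero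
  have hmap := Measure.map_linearMap_addHaar_eq_smul_addHaar
    (volume : Measure (J → ℂ)) hdet
  have hemb : MeasurableEmbedding e :=
    e.toContinuousLinearEquiv.toHomeomorph.measurableEmbedding
  have key (G : (J → ℂ) → ℂ) : ∫ T, G (U.mulVec T) =
      |(LinearMap.det (e : (J → ℂ) →ₗ[ℝ] (J → ℂ)))⁻¹| • ∫ T, G T := by
    have := hemb.integral_map (μ := volume) G
    simp only [he] at this
    rw [← this]
    change ∫ T, G T ∂(Measure.map (e : (J → ℂ) →ₗ[ℝ] (J → ℂ)) volume) = _
    rw [hmap, integral_smul_measure, ENNReal.toReal_ofReal (abs_nonneg _)]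
  have k1 := key fun T => F T * vectorWeight β T
  have k2 := key (vectorWeight β)
  simp only [hw] at k1 k2
  have hZ := integral_vectorWeight_ne_zero (J := J) hβ
  -- The Jacobian is not computed: the change of variables applied to the invariant weight alone,
  -- whose integral is nonzero, forces it to be `1`.
  have hc : |(LinearMap.det (e : (J → ℂ) →ₗ[ℝ] (J → ℂ)))⁻¹| = 1 := by
    rw [Complex.real_smul] at k2
    have := mul_right_cancel₀ hZ ((one_mul _).trans k2)
    exact_mod_cast this.symm
  rw [k1, hc, one_smul]

end ComplexGaussian

section Tensor

variable {D N : ℕ}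

/-! ### The quadratic form of the intermediate fields -/

/-- The tensor product of matrices, acting on tensors. -/
def tensorMatrix (B : Fin D → Matrix (Fin N) (Fin N) ℂ) :
    Matrix (Fin D → Fin N) (Fin D → Fin N) ℂ :=
  Matrix.of fun n n' => ∏ j, B j (n j) (n' j)

theorem tensorMatrix_mul (B C : Fin D → Matrix (Fin N) (Fin N) ℂ) :
    tensorMatrix B * tensorMatrix C = tensorMatrix (B * C) := by
  ext n n'
  simp only [tensorMatrix, Matrix.mul_apply, Matrix.of_apply, Pi.mul_apply,
    ← Finset.prod_mul_distrib]
  rw [Finset.prod_univ_sum, Fintype.piFinset_univ]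

theorem tensorMatrix_mulSingle_diagonal (i : Fin D) (a : Fin N → ℂ) :
    tensorMatrix (Pi.mulSingle i (Matrix.diagonal a)) =
      Matrix.diagonal fun n : Fin D → Fin N => a (n i) := by
  ext n n'
  rw [tensorMatrix, Matrix.of_apply]
  by_cases h : n = n'
  · subst h
    rw [Matrix.diagonal_apply_eq, Finset.prod_eq_single i]
    · simp
    · intro j _ hj
      simp [Pi.mulSingle_eq_of_ne hj]
    · simp
  · rw [Matrix.diagonal_apply_ne _ h]
    obtain ⟨j, hj⟩ := Function.ne_iff.1 h
    refine Finset.prod_eq_zero (Finset.mem_univ j) ?_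
    by_cases hji : j = i
    · subst hji
      simp [hj]
    · simp [Pi.mulSingle_eq_of_ne hji, hj]

theorem tensorMatrix_one : tensorMatrix (1 : Fin D → Matrix (Fin N) (Fin N) ℂ) = 1 := by
  ext n n'
  rw [tensorMatrix, Matrix.of_apply, Matrix.one_apply]
  split_ifs with h
  · subst h
    simp
  · obtain ⟨j, hj⟩ := Function.ne_iff.1 h
    exact Finset.prod_eq_zero (Finset.mem_univ j) (by simp [hj])

theorem tensorMatrix_conjTranspose (B : Fin D → Matrix (Fin N) (Fin N) ℂ) :
    (tensorMatrix B).conjTranspose = tensorMatrix fun j => (B j).conjTranspose := by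
  ext n n'
  simp [tensorMatrix, Matrix.conjTranspose_apply]

/-- `∑_i Tr (M_i Θ_i^t)`, where `Θ_i` is the partial contraction in position `i`. -/
def fieldForm (M : Fin D → Matrix (Fin N) (Fin N) ℂ) (T : Tensor D N) : ℂ :=
  ∑ i, ∑ s, ∑ s', M i s s' * partialContraction T i s s'

theorem tensorMatrix_mulSingle_mulVec (i : Fin D) (M : Matrix (Fin N) (Fin N) ℂ)
    (T : Tensor D N) (n : Fin D → Fin N) :
    (tensorMatrix (Pi.mulSingle i M)).mulVec T n =
      ∑ s', M (n i) s' * T (Function.update n i s') := by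
  rw [Matrix.mulVec, dotProduct]
  symm
  refine Finset.sum_of_injOn (Function.update n i) (Function.update_injective n i).injOn
    (by simp) (fun n' _ hn' => ?_) fun s' _ => ?_
  · obtain ⟨j, hji, hj⟩ : ∃ j, j ≠ i ∧ n j ≠ n' j := by
      by_contra! h
      refine hn' ⟨n' i, by simp, ?_⟩
      ext j
      by_cases hj : j = i
      · subst hj
        simp
      · simp [hj, h j hj]
    rw [tensorMatrix, Matrix.of_apply, Finset.prod_eq_zero (Finset.mem_univ j), zero_mul]
    simp [Pi.mulSingle_eq_of_ne hji, hj]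
  · rw [tensorMatrix, Matrix.of_apply, Finset.prod_eq_single i]
    · simp
    · intro j _ hj
      simp [hj]
    · simp

theorem sum_partialContraction (i : Fin D) (M : Matrix (Fin N) (Fin N) ℂ) (T : Tensor D N) :
    ∑ s, ∑ s', M s s' * partialContraction T i s s' =
      star T ⬝ᵥ (tensorMatrix (Pi.mulSingle i M)).mulVec T := by
  simp only [dotProduct, tensorMatrix_mulSingle_mulVec, partialContraction, Matrix.of_apply,
    Finset.mul_sum]
  calc _ = ∑ s, ∑ n : Fin D → Fin N, ∑ s', (if n i = s then
        M s s' * (star (T n) * T (Function.update n i s')) else 0) := by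
        refine Finset.sum_congr rfl fun s _ => ?_
        rw [Finset.sum_comm]
        refine Finset.sum_congr rfl fun n _ => Finset.sum_congr rfl fun s' _ => ?_
        rw [mul_ite, mul_zero]
    _ = ∑ n : Fin D → Fin N, ∑ s', M (n i) s' * (star (T n) * T (Function.update n i s')) := by
        rw [Finset.sum_comm]
        refine Finset.sum_congr rfl fun n _ => ?_
        rw [Finset.sum_comm]
        simp
    _ = _ := by
        refine Finset.sum_congr rfl fun n _ => Finset.sum_congr rfl fun s' _ => ?_
        rw [Pi.star_apply]
        ring

theorem fieldForm_eq (M : Fin D → Matrix (Fin N) (Fin N) ℂ) (T : Tensor D N) :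
    fieldForm M T = ∑ i, star T ⬝ᵥ (tensorMatrix (Pi.mulSingle i (M i))).mulVec T :=
  Finset.sum_congr rfl fun i _ => sum_partialContraction i (M i) T

/-- In eigenbases of the matrices `M_i`, the form is diagonal. -/
theorem fieldForm_mulVec_of_diagonalized {M U : Fin D → Matrix (Fin N) (Fin N) ℂ}
    {a : Fin D → Fin N → ℂ} (hU : ∀ i, (U i).conjTranspose * U i = 1)
    (hM : ∀ i, (U i).conjTranspose * M i * U i = Matrix.diagonal (a i)) (T : Tensor D N) :
    fieldForm M ((tensorMatrix U).mulVec T) =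
      ∑ n, (∑ i, a i (n i)) * (‖T n‖ ^ 2 : ℂ) := by
  rw [fieldForm_eq]
  have h (i : Fin D) : star ((tensorMatrix U).mulVec T) ⬝ᵥ
      (tensorMatrix (Pi.mulSingle i (M i))).mulVec ((tensorMatrix U).mulVec T) =
      ∑ n, a i (n i) * (‖T n‖ ^ 2 : ℂ) := by
    rw [Matrix.star_mulVec, ← Matrix.dotProduct_mulVec, Matrix.mulVec_mulVec,
      Matrix.mulVec_mulVec, tensorMatrix_conjTranspose, tensorMatrix_mul, tensorMatrix_mul]
    have : (fun j => (U j).conjTranspose) * Pi.mulSingle i (M i) * U =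
        Pi.mulSingle i (Matrix.diagonal (a i)) := by
      funext j
      by_cases hj : j = i
      · subst hj
        simp [← hM, mul_assoc]
      · simp [Pi.mulSingle_eq_of_ne hj, hU]
    rw [this, tensorMatrix_mulSingle_diagonal]
    simp only [dotProduct, Matrix.mulVec_diagonal, Pi.star_apply]
    refine Finset.sum_congr rfl fun n _ => ?_
    rw [← Complex.conj_mul']
    simp only [RCLike.star_def]
    ring
  simp only [h]
  rw [Finset.sum_comm]
  simp only [Finset.sum_mul]

theorem sum_normSq_mulVec_of_unitary {J : Type*} [Fintype J] [DecidableEq J] {U : Matrix J J ℂ}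
    (hU : U.conjTranspose * U = 1) (T : J → ℂ) :
    ∑ n, ‖U.mulVec T n‖ ^ 2 = ∑ n, ‖T n‖ ^ 2 := by
  have h (S : J → ℂ) : ((∑ n, ‖S n‖ ^ 2 : ℝ) : ℂ) = star S ⬝ᵥ S := by
    simp only [dotProduct, Pi.star_apply, RCLike.star_def, Complex.conj_mul']
    push_cast
    rfl
  apply Complex.ofReal_injective
  rw [h, h, Matrix.star_mulVec, ← Matrix.dotProduct_mulVec, Matrix.mulVec_mulVec, hU,
    Matrix.one_mulVec]

theorem vectorWeight_eq_exp {J : Type*} [Fintype J] (β : ℝ) (T : J → ℂ) :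
    vectorWeight β T = (Real.exp (-β * ∑ n, ‖T n‖ ^ 2) : ℂ) := by
  rw [vectorWeight, ← Complex.ofReal_prod, ← Real.exp_sum, Finset.mul_sum]

theorem tensorWeight_eq_vectorWeight (κ : ℝ) (T : Tensor D N) :
    (tensorWeight κ T : ℂ) = vectorWeight (κ * (N : ℝ) ^ ((D : ℤ) - 1)) T := by
  rw [vectorWeight_eq_exp, tensorWeight]
  simp only [Complex.normSq_eq_norm_sq, neg_mul]

theorem tensorExpect_eq (κ : ℝ) (F : Tensor D N → ℂ) :
    tensorExpect D N κ F =
      (∫ T, F T * vectorWeight (κ * (N : ℝ) ^ ((D : ℤ) - 1)) T) /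
        ∫ T : Tensor D N, vectorWeight (κ * (N : ℝ) ^ ((D : ℤ) - 1)) T := by
  simp only [tensorExpect, ← integral_complex_ofReal, tensorWeight_eq_vectorWeight]

theorem exists_eigenvalues {M : Matrix (Fin N) (Fin N) ℂ} (hM : M.IsHermitian) :
    ∃ (U : Matrix (Fin N) (Fin N) ℂ) (a : Fin N → ℂ), U.conjTranspose * U = 1 ∧
      U.conjTranspose * M * U = Matrix.diagonal a ∧ ∀ q : ℕ, (M ^ q).trace = ∑ s, a s ^ q := by
  have h1 : (hM.eigenvectorUnitary : Matrix (Fin N) (Fin N) ℂ).conjTranspose *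
      hM.eigenvectorUnitary = 1 := Unitary.coe_star_mul_self hM.eigenvectorUnitary
  have h2 := mul_eq_one_comm.1 h1
  have h3 := hM.conjStarAlgAut_star_eigenvectorUnitary
  rw [Unitary.conjStarAlgAut_star_apply] at h3
  refine ⟨hM.eigenvectorUnitary.1, RCLike.ofReal ∘ hM.eigenvalues, h1, h3, fun q => ?_⟩
  set U : Matrix (Fin N) (Fin N) ℂ := hM.eigenvectorUnitary.1
  have h4 : (U.conjTranspose * M * U) ^ q = U.conjTranspose * M ^ q * U := by
    induction q with
    | zero => simp [h1]
    | succ q ih =>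
      rw [pow_succ, ih, pow_succ]
      calc _ = U.conjTranspose * M ^ q * (U * U.conjTranspose) * M * U := by
            simp only [Matrix.mul_assoc]
        _ = _ := by rw [h2, Matrix.mul_one, Matrix.mul_assoc U.conjTranspose]
  have h5 : (M ^ q).trace = ((U.conjTranspose * M * U) ^ q).trace := by
    rw [h4, Matrix.trace_mul_cycle, h2, Matrix.one_mul]
  have h6 : U.conjTranspose * M * U = Matrix.diagonal (RCLike.ofReal ∘ hM.eigenvalues) := h3
  rw [h5, h6, Matrix.diagonal_pow, Matrix.trace_diagonal]
  rfl

/-! ### The symbol of `Ŷ` as the logarithm of an inverse determinant -/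

theorem sum_boundedExponents {A : Type*} [AddCommMonoid A] {k : ℕ} (hk : k ≠ 0)
    (G : (Fin D → ℕ) → A) :
    (∑ q ∈ boundedExponents D k, if k = ∑ i, q.1 i then G q.1 else 0) =
      ∑ q ∈ Finset.univ.piAntidiag k, G q := by
  rw [← Finset.sum_filter]
  refine Finset.sum_nbij (fun q => q.1) (fun q hq => ?_) Subtype.val_injective.injOn
    (fun q hq => ?_) fun _ _ => rfl
  · simp [(Finset.mem_filter.1 hq).2]
  · have hq' : ∑ i, q i = k := by simpa using hq
    have h0 : q ≠ 0 := by
      rintro rfl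
      simp at hq'
      exact hk hq'.symm
    exact ⟨⟨q, h0⟩, by simp [mem_boundedExponents, hq'], rfl⟩

/-- The prefactor `(-1)^D / N^D` cancels the factors `-N` of the sources, the product of power sums
is a sum over multi-indices `n`, and the multinomial theorem then sums over `|q| = k`. -/
theorem symbolY_eq_of_trace_pow (hN : 1 ≤ N) (κ : ℝ) {y : Fin D × ℕ → ℂ} {a : Fin D → Fin N → ℂ}
    (hy : ∀ i q, y (i, q) = -(N : ℂ) * ∑ s, a i s ^ q) :
    symbolY N κ y = PowerSeries.mk fun k => (∑ n : Fin D → Fin N,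
      ((-Complex.I * ((κ⁻¹ * (√(2 * (N : ℝ) ^ ((D : ℤ) - 2)))⁻¹ : ℝ) : ℂ)) *
        ∑ i, a i (n i)) ^ k) / k := by
  ext k
  rw [symbolY, PowerSeries.coeff_mk, PowerSeries.coeff_mk]
  rcases eq_or_ne k 0 with rfl | hk
  · simp only [Nat.cast_zero, div_zero]
    refine Finset.sum_eq_zero fun q _ => if_neg (sum_pos_of_ne_zero q).ne
  rw [sum_boundedExponents hk fun q => scalarY D N κ q • ∏ i, y (i, q i)]
  simp only [mul_pow]
  simp only [Finset.sum_pow_eq_sum_piAntidiag, Finset.mul_sum, Finset.sum_div]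
  rw [Finset.sum_comm]
  refine Finset.sum_congr rfl fun q hq => ?_
  have hq' : ∑ i, q i = k := by simpa using hq
  have hN' : (N : ℂ) ≠ 0 := by exact_mod_cast (by omega : N ≠ 0)
  have h : ∑ n : Fin D → Fin N, ∏ i, a i (n i) ^ q i = ∏ i, ∑ s, a i s ^ q i := by
    rw [Finset.prod_univ_sum, Fintype.piFinset_univ]
  rw [← Finset.sum_div, ← Finset.mul_sum, ← Finset.mul_sum, h]
  simp only [hy, Finset.prod_mul_distrib, scalarY, hq', smul_eq_mul]
  have h1 : (-1 : ℂ) ^ D / (N : ℂ) ^ D * (-(N : ℂ)) ^ D = 1 := by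
    rw [div_mul_eq_mul_div, ← mul_pow, neg_mul_neg, one_mul, div_self (pow_ne_zero _ hN')]
  rw [Finset.prod_const, Finset.card_univ, Fintype.card_fin]
  linear_combination ((-Complex.I) ^ k / (k : ℂ) *
    ((κ⁻¹ * (√(2 * (N : ℝ) ^ ((D : ℤ) - 2)))⁻¹ : ℝ) : ℂ) ^ k *
    (Nat.multinomial Finset.univ q : ℂ) * ∏ i, ∑ s, a i s ^ q i) * h1

/-- The exponential of the symbol of `Ŷ` at Hermitian matrices is a Gaussian integral over
tensors. -/
theorem coeff_exp_subst_symbolY (hN : 1 ≤ N) {κ : ℝ} (hκ : 0 < κ)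
    {M : Fin D → Matrix (Fin N) (Fin N) ℂ} (hM : ∀ i, (M i).IsHermitian) (k : ℕ) :
    PowerSeries.coeff k ((PowerSeries.exp ℂ).subst
      (symbolY N κ fun v : Fin D × ℕ => -(N : ℂ) * (M v.1 ^ v.2).trace)) =
      (-Complex.I * ((κ⁻¹ * (√(2 * (N : ℝ) ^ ((D : ℤ) - 2)))⁻¹ : ℝ) : ℂ) *
        ((κ * (N : ℝ) ^ ((D : ℤ) - 1) : ℝ) : ℂ)) ^ k *
      tensorExpect D N κ fun T => fieldForm M T ^ k / (k.factorial : ℂ) := by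
  choose U a hU hMU ha using fun i => exists_eigenvalues (hM i)
  have hβ : 0 < κ * (N : ℝ) ^ ((D : ℤ) - 1) := by
    have : (0 : ℝ) < N := by exact_mod_cast hN
    positivity
  rw [tensorExpect_eq]
  generalize κ * (N : ℝ) ^ ((D : ℤ) - 1) = β at hβ
  have hβ' : (β : ℂ) ≠ 0 := by exact_mod_cast hβ.ne'
  have hUU : (tensorMatrix U).conjTranspose * tensorMatrix U = 1 := by
    rw [tensorMatrix_conjTranspose, tensorMatrix_mul, ← tensorMatrix_one]
    congr 1
    funext j
    exact hU j
  -- The tensor product of the eigenbases is unitary, so it can be absorbed into `T` and leaves a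
  -- diagonal form.
  rw [integral_comp_mulVec_div hUU (fun T => by
    rw [vectorWeight_eq_exp, vectorWeight_eq_exp, sum_normSq_mulVec_of_unitary hUU]) hβ]
  simp only [fieldForm_mulVec_of_diagonalized hU hMU]
  have h := congrArg (PowerSeries.coeff k)
    (mk_integral_diagonal_form hβ fun n : Fin D → Fin N => ∑ i, a i (n i))
  rw [PowerSeries.coeff_mk] at h
  rw [h, exp_subst_sum_log _ (symbolY_eq_of_trace_pow hN κ fun i q => by rw [← ha]),
    ← PowerSeries.coeff_rescale, map_prod (PowerSeries.rescale _)]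
  congr 1
  refine Finset.prod_congr rfl fun n _ => ?_
  ext m
  rw [PowerSeries.coeff_rescale, PowerSeries.coeff_mk, PowerSeries.coeff_mk, ← mul_pow]
  congr 1
  field_simp

end Tensor

/-! ### Gaussian integrals over several Hermitian matrices -/

section Matrices

variable {D N : ℕ}

/-- The coordinates of `D` Hermitian matrices. -/
abbrev FieldCoords (D N : ℕ) := Fin D → Fin N → Fin N → ℝ

/-- The Gaussian weight of `D` Hermitian matrices. -/
def fieldWeight (ω : FieldCoords D N) : ℂ := ∏ i, (matrixWeight (hermitianOf (ω i)) : ℂ)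

/-- The coefficients of the quadratic form `(N/2) Tr M²`. -/
def coordRate (N : ℕ) (j k : Fin N) : ℝ := if j = k then N / 2 else N

theorem coordRate_pos (hN : 1 ≤ N) (j k : Fin N) : 0 < coordRate N j k := by
  have : (0 : ℝ) < N := by exact_mod_cast hN
  rw [coordRate]
  split_ifs <;> positivity

/-- The real coordinates `A j k` and `A k j` both enter the entries `(j, k)` and `(k, j)`, so
identities hold only after pairing transposed terms. -/
theorem sum_sum_eq_of_symmetrized {f g : Fin N → Fin N → ℂ}
    (h : ∀ j k, f j k + f k j = g j k + g k j) : ∑ j, ∑ k, f j k = ∑ j, ∑ k, g j k := by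
  have hf (f : Fin N → Fin N → ℂ) :
      2 * ∑ j, ∑ k, f j k = ∑ j, ∑ k, (f j k + f k j) := by
    simp only [Finset.sum_add_distrib]
    rw [Finset.sum_comm (f := fun j k => f k j)]
    ring
  have : (2 : ℂ) * ∑ j, ∑ k, f j k = 2 * ∑ j, ∑ k, g j k := by
    rw [hf, hf]
    simp only [h]
  exact mul_left_cancel₀ two_ne_zero this

theorem trace_hermitianOf_sq (A : Fin N → Fin N → ℝ) :
    (N / 2 : ℂ) * (hermitianOf A * hermitianOf A).trace =
      ∑ j, ∑ k, (coordRate N j k : ℂ) * (A j k : ℂ) ^ 2 := by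
  simp only [Matrix.trace, Matrix.diag_apply, Matrix.mul_apply, Finset.mul_sum]
  refine sum_sum_eq_of_symmetrized fun j k => ?_
  rcases lt_trichotomy j k with h | h | h
  · simp only [hermitianOf, Matrix.of_apply, coordRate, h, h.not_gt, h.ne, h.ne', if_true, if_false]
    push_cast
    linear_combination -(N : ℂ) * (A k j : ℂ) ^ 2 * Complex.I_sq
  · subst h
    simp [hermitianOf, coordRate]
    ring
  · simp only [hermitianOf, Matrix.of_apply, coordRate, h, h.not_gt, h.ne, h.ne', if_true, if_false]
    push_cast
    linear_combination -(N : ℂ) * (A j k : ℂ) ^ 2 * Complex.I_sq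

theorem matrixWeight_hermitianOf (A : Fin N → Fin N → ℝ) :
    matrixWeight (hermitianOf A) = ∏ j, ∏ k, Real.exp (-coordRate N j k * A j k ^ 2) := by
  have h : (N / 2 : ℝ) * (hermitianOf A * hermitianOf A).trace.re =
      ∑ j, ∑ k, coordRate N j k * A j k ^ 2 := by
    have := congrArg Complex.re (trace_hermitianOf_sq A)
    rw [show (N / 2 : ℂ) = ((N / 2 : ℝ) : ℂ) by push_cast; rfl, Complex.re_ofReal_mul] at this
    rw [this]
    norm_cast
  rw [matrixWeight, neg_mul, h]
  simp only [← Real.exp_sum, neg_mul, Finset.sum_neg_distrib]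

theorem prod_coord_mul_fieldWeight (f : Fin D × Fin N × Fin N → ℝ → ℂ) (ω : FieldCoords D N) :
    (∏ v, f v (ω v.1 v.2.1 v.2.2)) * fieldWeight ω =
      ∏ i, ∏ j, ∏ k, (f (i, j, k) (ω i j k) *
        (Real.exp (-coordRate N j k * ω i j k ^ 2) : ℂ)) := by
  simp only [fieldWeight, matrixWeight_hermitianOf, Fintype.prod_prod_type, Complex.ofReal_prod,
    Finset.prod_mul_distrib]

theorem integral_prod_coord_mul_fieldWeight (f : Fin D × Fin N × Fin N → ℝ → ℂ) :
    ∫ ω : FieldCoords D N, (∏ v, f v (ω v.1 v.2.1 v.2.2)) * fieldWeight ω =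
      ∏ v, ∫ x : ℝ, f v x * (Real.exp (-coordRate N v.2.1 v.2.2 * x ^ 2) : ℂ) := by
  simp only [prod_coord_mul_fieldWeight]
  rw [Fintype.prod_prod_type, integral_fintype_prod_volume_eq_prod
    fun i (A : Fin N → Fin N → ℝ) => ∏ j, ∏ k, (f (i, j, k) (A j k) *
        (Real.exp (-coordRate N j k * A j k ^ 2) : ℂ))]
  refine Finset.prod_congr rfl fun i _ => ?_
  rw [Fintype.prod_prod_type, integral_fintype_prod_volume_eq_prod
    fun j (A : Fin N → ℝ) => ∏ k, (f (i, j, k) (A k) *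
        (Real.exp (-coordRate N j k * A k ^ 2) : ℂ))]
  refine Finset.prod_congr rfl fun j _ => ?_
  rw [integral_fintype_prod_volume_eq_prod
    fun k (x : ℝ) => (f (i, j, k) x * (Real.exp (-coordRate N j k * x ^ 2) : ℂ))]

theorem integrable_prod_coord_pow_mul_fieldWeight (hN : 1 ≤ N) (α : Fin D × Fin N × Fin N → ℕ) :
    Integrable fun ω : FieldCoords D N =>
      (∏ v, (ω v.1 v.2.1 v.2.2 : ℂ) ^ α v) * fieldWeight ω := by
  simp only [prod_coord_mul_fieldWeight fun v x => (x : ℂ) ^ α v]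
  refine Integrable.fintype_prod (f := fun i (A : Fin N → Fin N → ℝ) => ∏ j, ∏ k,
    ((A j k : ℂ) ^ α (i, j, k) * (Real.exp (-coordRate N j k * A j k ^ 2) : ℂ))) fun i => ?_
  refine Integrable.fintype_prod (f := fun j (A : Fin N → ℝ) => ∏ k,
    ((A k : ℂ) ^ α (i, j, k) * (Real.exp (-coordRate N j k * A k ^ 2) : ℂ))) fun j => ?_
  refine Integrable.fintype_prod (f := fun k (x : ℝ) =>
    ((x : ℂ) ^ α (i, j, k) * (Real.exp (-coordRate N j k * x ^ 2) : ℂ))) fun k => ?_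
  refine (integrable_pow_mul_exp_neg_sq (coordRate_pos hN j k) (α (i, j, k))).ofReal.congr
    (Filter.Eventually.of_forall fun x => ?_)
  simp

theorem integral_fieldWeight :
    ∫ ω : FieldCoords D N, fieldWeight ω =
      ∏ v : Fin D × Fin N × Fin N, ∫ x : ℝ,
        (Real.exp (-coordRate N v.2.1 v.2.2 * x ^ 2) : ℂ) := by
  simpa using integral_prod_coord_mul_fieldWeight (D := D) (N := N) fun _ _ => 1

theorem integral_prod_coord_pow_mul_fieldWeight (α : Fin D × Fin N × Fin N → ℕ) :
    (∫ ω : FieldCoords D N, (∏ v, (ω v.1 v.2.1 v.2.2 : ℂ) ^ α v) * fieldWeight ω) /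
      (∫ ω : FieldCoords D N, fieldWeight ω) =
      ∏ v, gaussianMoment (coordRate N v.2.1 v.2.2) (α v) := by
  rw [integral_prod_coord_mul_fieldWeight fun v x => (x : ℂ) ^ α v, integral_fieldWeight,
    ← Finset.prod_div_distrib]
  rfl

/-- The coefficient of the coordinate `A j k` in `∑ (hermitianOf A) s s' * B s s'`. -/
def coordCoeff (B : Matrix (Fin N) (Fin N) ℂ) (j k : Fin N) : ℂ :=
  if j < k then B j k + B k j else if j = k then B j j else Complex.I * (B k j - B j k)

theorem sum_hermitianOf_mul (A : Fin N → Fin N → ℝ) (B : Matrix (Fin N) (Fin N) ℂ) :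
    ∑ s, ∑ s', hermitianOf A s s' * B s s' = ∑ j, ∑ k, coordCoeff B j k * (A j k : ℂ) := by
  refine sum_sum_eq_of_symmetrized fun j k => ?_
  rcases lt_trichotomy j k with h | h | h
  · simp only [hermitianOf, Matrix.of_apply, coordCoeff, h, h.not_gt, h.ne', if_true, if_false]
    ring
  · subst h
    simp [hermitianOf, coordCoeff]
    ring
  · simp only [hermitianOf, Matrix.of_apply, coordCoeff, h, h.not_gt, h.ne', if_true, if_false]
    ring

/-- Off the diagonal, `((B j k + B k j)² - (B k j - B j k)²) / (4N)` is `B j k * B k j / N`, the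
contribution of two transposed terms; the halved rate on the diagonal gives the same `1/(2N)`. -/
theorem sum_coordCoeff_sq (hN : 1 ≤ N) (B : Matrix (Fin N) (Fin N) ℂ) :
    ∑ j, ∑ k, coordCoeff B j k ^ 2 / (4 * coordRate N j k) = (B * B).trace / (2 * N) := by
  have hN' : (N : ℂ) ≠ 0 := by exact_mod_cast (by omega : N ≠ 0)
  simp only [Matrix.trace, Matrix.diag_apply, Matrix.mul_apply, Finset.sum_div]
  refine sum_sum_eq_of_symmetrized fun j k => ?_
  rcases lt_trichotomy j k with h | h | h
  · simp only [coordCoeff, coordRate, h, h.not_gt, h.ne, h.ne', if_true, if_false, mul_pow,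
      Complex.I_sq]
    push_cast
    field_simp
    ring
  · subst h
    simp only [coordCoeff, coordRate, lt_irrefl, if_true, if_false]
    push_cast
    field_simp
    ring
  · simp only [coordCoeff, coordRate, h, h.not_gt, h.ne, h.ne', if_true, if_false, mul_pow,
      Complex.I_sq]
    push_cast
    field_simp
    ring

/-- The generating series of the moments of a linear form in Gaussian Hermitian matrices. -/
theorem mk_integral_fieldForm (hN : 1 ≤ N) (T : Tensor D N) :
    PowerSeries.mk (fun n => (∫ ω : FieldCoords D N,
      fieldForm (fun i => hermitianOf (ω i)) T ^ n / (n.factorial : ℂ) * fieldWeight ω) /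
        ∫ ω : FieldCoords D N, fieldWeight ω) =
      PowerSeries.expand 2 two_ne_zero (PowerSeries.rescale (melonicInteraction T / (2 * N))
        (PowerSeries.exp ℂ)) := by
  have h (ω : FieldCoords D N) : fieldForm (fun i => hermitianOf (ω i)) T =
      ∑ v : Fin D × Fin N × Fin N,
        coordCoeff (partialContraction T v.1) v.2.1 v.2.2 * (ω v.1 v.2.1 v.2.2 : ℂ) := by
    simp only [fieldForm, sum_hermitianOf_mul, Fintype.sum_prod_type]
  simp only [h]
  rw [mk_integral_linearForm (integrable_prod_coord_pow_mul_fieldWeight hN)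
    integral_prod_coord_pow_mul_fieldWeight]
  rw [Finset.prod_congr rfl fun v _ => mk_gaussianMoment (coordRate_pos hN v.2.1 v.2.2) _,
    ← map_prod, ← rescale_sum_exp]
  simp only [Fintype.sum_prod_type, sum_coordCoeff_sq hN, melonicInteraction, Finset.sum_div]

end Matrices

section Expectation

variable {D N : ℕ}

/-! ### Expectations of polynomials in the matrix entries -/

/-- Polynomials in the real coordinates of `D` Hermitian matrices. -/
abbrev FieldPolynomial (D N : ℕ) := MvPolynomial (Fin D × Fin N × Fin N) ℂ

/-- Evaluation of a polynomial at given coordinates. -/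
def evalField (ω : FieldCoords D N) : FieldPolynomial D N →ₐ[ℂ] ℂ :=
  MvPolynomial.aeval fun v => (ω v.1 v.2.1 v.2.2 : ℂ)

/-- Restricting to polynomials makes the expectation a linear functional on a commutative algebra,
the form that `sourceSeries` requires. -/
theorem integrable_evalField_mul_fieldWeight (hN : 1 ≤ N) (p : FieldPolynomial D N) :
    Integrable fun ω : FieldCoords D N => evalField ω p * fieldWeight ω := by
  induction p using MvPolynomial.induction_on' with
  | monomial u a =>
    refine ((integrable_prod_coord_pow_mul_fieldWeight hN u).const_mul a).congr
      (Filter.Eventually.of_forall fun ω => ?_)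
    simp only [evalField, MvPolynomial.aeval_monomial]
    rw [Finsupp.prod_fintype _ _ fun v => pow_zero _, Algebra.algebraMap_self, RingHom.id_apply,
      mul_assoc]
  | add p q hp hq =>
    refine (hp.add hq).congr (Filter.Eventually.of_forall fun ω => ?_)
    simp only [map_add, Pi.add_apply, add_mul]

/-- The normalised Gaussian expectation of a polynomial. -/
def fieldExpect (hN : 1 ≤ N) : FieldPolynomial D N →ₗ[ℂ] ℂ where
  toFun p := (∫ ω : FieldCoords D N, evalField ω p * fieldWeight ω) /
    ∫ ω : FieldCoords D N, fieldWeight ω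
  map_add' p q := by
    simp only [map_add, add_mul]
    rw [integral_add (integrable_evalField_mul_fieldWeight hN p)
      (integrable_evalField_mul_fieldWeight hN q), add_div]
  map_smul' c p := by
    simp only [map_smul, smul_eq_mul, mul_assoc, RingHom.id_apply]
    rw [integral_const_mul, mul_div_assoc]

theorem fieldExpect_apply (hN : 1 ≤ N) (p : FieldPolynomial D N) :
    fieldExpect hN p = (∫ ω : FieldCoords D N, evalField ω p * fieldWeight ω) /
      ∫ ω : FieldCoords D N, fieldWeight ω := rfl

/-- The Hermitian matrices with indeterminate coordinates. -/
def genericHermitian (i : Fin D) : Matrix (Fin N) (Fin N) (FieldPolynomial D N) :=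
  Matrix.of fun j k =>
    if j < k then MvPolynomial.X (i, j, k) + MvPolynomial.C Complex.I * MvPolynomial.X (i, k, j)
    else if j = k then MvPolynomial.X (i, j, j)
    else MvPolynomial.X (i, k, j) - MvPolynomial.C Complex.I * MvPolynomial.X (i, j, k)

theorem map_genericHermitian (ω : FieldCoords D N) (i : Fin D) :
    (evalField ω).mapMatrix (genericHermitian i) = hermitianOf (ω i) := by
  ext j k
  simp only [AlgHom.mapMatrix_apply, Matrix.map_apply, genericHermitian, hermitianOf,
    Matrix.of_apply]
  split_ifs <;> simp [evalField]

/-- The polynomials `-N Tr (M_i ^ p)`. -/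
def timeSource (v : Fin D × ℕ) : FieldPolynomial D N :=
  MvPolynomial.C (-(N : ℂ)) * (genericHermitian v.1 ^ v.2).trace

theorem evalField_timeSource (ω : FieldCoords D N) (v : Fin D × ℕ) :
    evalField ω (timeSource v) = -(N : ℂ) * (hermitianOf (ω v.1) ^ v.2).trace := by
  rw [timeSource, map_mul, ← map_genericHermitian, ← map_pow, AlgHom.mapMatrix_apply,
    ← AddMonoidHom.map_trace]
  congr 1
  simp [evalField]

/-- The Gaussian weight is a product over the colours, so the expectation factorises. -/
theorem fieldExpect_prod_timeSource (hN : 1 ≤ N) (α : Fin D → ℕ →₀ ℕ) :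
    fieldExpect hN (∏ i, (α i).prod fun p k => ((k.factorial : ℂ)⁻¹) • timeSource (i, p) ^ k) =
      ∏ i, oneMatrixPartition N (α i) := by
  rw [fieldExpect_apply]
  simp only [map_prod, map_finsuppProd, map_smul, map_pow, evalField_timeSource, fieldWeight,
    ← Finset.prod_mul_distrib]
  rw [integral_fintype_prod_volume_eq_prod fun i (A : Fin N → Fin N → ℝ) =>
      ((α i).prod fun p k => ((k.factorial : ℂ)⁻¹) • (-(N : ℂ) * (hermitianOf A ^ p).trace) ^ k) *
        (matrixWeight (hermitianOf A) : ℂ),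
    integral_fintype_prod_volume_eq_prod fun _ (A : Fin N → Fin N → ℝ) =>
        (matrixWeight (hermitianOf A) : ℂ), ← Finset.prod_div_distrib]
  refine Finset.prod_congr rfl fun i _ => ?_
  rw [oneMatrixPartition, matrixExpect, ← integral_complex_ofReal]
  simp only [smul_eq_mul, div_eq_inv_mul]

theorem matrixProduct_eq (hN : 1 ≤ N) :
    matrixProduct D N = sourceSeries (fieldExpect hN) timeSource 1 :=
  matrixProduct_eq_sourceSeries N _ _ (fieldExpect_prod_timeSource hN)

theorem map_symbolY {R S : Type*} [CommRing R] [Algebra ℂ R] [CommRing S] [Algebra ℂ S]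
    (κ : ℝ) (f : R →ₐ[ℂ] S) (y : Fin D × ℕ → R) :
    PowerSeries.map (f : R →+* S) (symbolY N κ y) = symbolY N κ fun v => f (y v) := by
  ext k
  rw [PowerSeries.coeff_map, symbolY, symbolY, PowerSeries.coeff_mk, PowerSeries.coeff_mk, map_sum]
  refine Finset.sum_congr rfl fun q _ => ?_
  split_ifs <;> simp

theorem evalField_symbolY_exp (hN : 1 ≤ N) {κ : ℝ} (hκ : 0 < κ) (ω : FieldCoords D N) (k : ℕ) :
    evalField ω (∑ n ∈ Finset.range (k + 1), ((n.factorial : ℂ)⁻¹) •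
      PowerSeries.coeff k (symbolY N κ (timeSource (D := D) (N := N)) ^ n)) =
      (-Complex.I * ((κ⁻¹ * (√(2 * (N : ℝ) ^ ((D : ℤ) - 2)))⁻¹ : ℝ) : ℂ) *
        ((κ * (N : ℝ) ^ ((D : ℤ) - 1) : ℝ) : ℂ)) ^ k *
      tensorExpect D N κ fun T =>
        fieldForm (fun i => hermitianOf (ω i)) T ^ k / (k.factorial : ℂ) := by
  rw [← coeff_exp_subst_symbolY hN hκ fun i => hermitianOf_isHermitian (ω i), coeff_exp_subst]
  · rw [map_sum]
    refine Finset.sum_congr rfl fun n _ => ?_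
    simp only [← evalField_timeSource]
    rw [← map_symbolY, ← map_pow, PowerSeries.coeff_map, map_smul, smul_eq_mul]
    rfl
  · rw [← PowerSeries.coeff_zero_eq_constantCoeff_apply, symbolY, PowerSeries.coeff_mk]
    exact Finset.sum_eq_zero fun q _ => if_neg (sum_pos_of_ne_zero q).ne

/-! ### Exchange of the matrix and tensor integrals -/

/-- The coordinate functions on matrices and tensors. -/
def coordinateFunctions (D N : ℕ) : Set (FieldCoords D N × Tensor D N → ℂ) :=
  (Set.range fun (v : Fin D × Fin N × Fin N) z => (z.1 v.1 v.2.1 v.2.2 : ℂ)) ∪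
    (Set.range fun n z => z.2 n) ∪ Set.range fun n z => star (z.2 n)

theorem exists_monomial_of_mem_closure {f : FieldCoords D N × Tensor D N → ℂ}
    (hf : f ∈ Submonoid.closure (coordinateFunctions D N)) :
    ∃ (α : Fin D × Fin N × Fin N → ℕ) (k l : (Fin D → Fin N) → ℕ), ∀ z,
      f z = (∏ v, (z.1 v.1 v.2.1 v.2.2 : ℂ) ^ α v) * ∏ n, (z.2 n ^ k n * star (z.2 n) ^ l n) := by
  classical
  induction hf using Submonoid.closure_induction with
  | mem f hf =>
    rcases hf with (⟨v, rfl⟩ | ⟨n, rfl⟩) | ⟨n, rfl⟩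
    · refine ⟨Pi.single v 1, 0, 0, fun z => ?_⟩
      simp [Pi.single_apply, pow_ite]
    · refine ⟨0, Pi.single n 1, 0, fun z => ?_⟩
      simp [Pi.single_apply, pow_ite]
    · refine ⟨0, 0, Pi.single n 1, fun z => ?_⟩
      simp [Pi.single_apply, pow_ite]
  | one => exact ⟨0, 0, 0, fun z => by simp⟩
  | mul f g _ _ hf hg =>
    obtain ⟨α, k, l, hf⟩ := hf
    obtain ⟨α', k', l', hg⟩ := hg
    refine ⟨α + α', k + k', l + l', fun z => ?_⟩
    rw [Pi.mul_apply, hf, hg]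
    simp only [Pi.add_apply, pow_add, Finset.prod_mul_distrib]
    ring

/-- Monomials split into a matrix factor and a tensor factor, each integrable against its weight.
This is the joint integrability behind Fubini's theorem. -/
theorem integrable_of_mem_adjoin (hN : 1 ≤ N) {β : ℝ} (hβ : 0 < β)
    {f : FieldCoords D N × Tensor D N → ℂ}
    (hf : f ∈ Algebra.adjoin ℂ (coordinateFunctions D N)) :
    Integrable (fun z => f z * (fieldWeight z.1 * vectorWeight β z.2))
      ((volume : Measure (FieldCoords D N)).prod (volume : Measure (Tensor D N))) := by
  rw [← Subalgebra.mem_toSubmodule, Algebra.adjoin_eq_span] at hf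
  induction hf using Submodule.span_induction with
  | mem f hf =>
    obtain ⟨α, k, l, h⟩ := exists_monomial_of_mem_closure hf
    refine ((integrable_prod_coord_pow_mul_fieldWeight hN α).mul_prod
      (integrable_monomial_mul_vectorWeight hβ k l)).congr
      (Filter.Eventually.of_forall fun z => ?_)
    simp only [h]
    ring
  | zero => simp
  | add f g _ _ hf hg =>
    refine (hf.add hg).congr (Filter.Eventually.of_forall fun z => ?_)
    simp only [Pi.add_apply, add_mul]
  | smul c f _ hf =>
    refine (hf.const_mul c).congr (Filter.Eventually.of_forall fun z => ?_)
    simp only [Pi.smul_apply, smul_eq_mul, mul_assoc]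

theorem sum_mem_subalgebra {Ω ι : Type*} (A : Subalgebra ℂ (Ω → ℂ)) {s : Finset ι}
    {f : ι → Ω → ℂ} (h : ∀ i ∈ s, f i ∈ A) : (fun z => ∑ i ∈ s, f i z) ∈ A := by
  have := sum_mem h
  rwa [Finset.sum_fn] at this

theorem fieldForm_mem_adjoin :
    (fun z : FieldCoords D N × Tensor D N => fieldForm (fun i => hermitianOf (z.1 i)) z.2) ∈
      Algebra.adjoin ℂ (coordinateFunctions D N) := by
  set A := Algebra.adjoin ℂ (coordinateFunctions D N) with hA
  have hω (v : Fin D × Fin N × Fin N) :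
      (fun z : FieldCoords D N × Tensor D N => (z.1 v.1 v.2.1 v.2.2 : ℂ)) ∈ A :=
    Algebra.subset_adjoin (Or.inl (Or.inl ⟨v, rfl⟩))
  have hT (n : Fin D → Fin N) : (fun z : FieldCoords D N × Tensor D N => z.2 n) ∈ A :=
    Algebra.subset_adjoin (Or.inl (Or.inr ⟨n, rfl⟩))
  have hT' (n : Fin D → Fin N) : (fun z : FieldCoords D N × Tensor D N => star (z.2 n)) ∈ A :=
    Algebra.subset_adjoin (Or.inr ⟨n, rfl⟩)
  have hI : (fun _ : FieldCoords D N × Tensor D N => Complex.I) ∈ A := A.algebraMap_mem Complex.I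
  refine sum_mem_subalgebra A fun i _ => sum_mem_subalgebra A fun s _ =>
    sum_mem_subalgebra A fun s' _ => A.mul_mem ?_ (sum_mem_subalgebra A fun n _ => ?_)
  · simp only [hermitianOf, Matrix.of_apply]
    split_ifs
    · exact A.add_mem (hω (i, s, s')) (A.mul_mem hI (hω (i, s', s)))
    · exact hω (i, s, s)
    · exact A.sub_mem (hω (i, s', s)) (A.mul_mem hI (hω (i, s, s')))
  · split_ifs
    · exact A.mul_mem (hT' n) (hT _)
    · exact A.zero_mem

theorem integral_fieldForm_swap (hN : 1 ≤ N) {β : ℝ} (hβ : 0 < β) (k : ℕ) (c : ℂ) :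
    (∫ ω : FieldCoords D N, ((∫ T : Tensor D N,
        fieldForm (fun i => hermitianOf (ω i)) T ^ k / c * vectorWeight β T) /
        (∫ T : Tensor D N, vectorWeight β T)) * fieldWeight ω) /
        (∫ ω : FieldCoords D N, fieldWeight ω) =
      (∫ T : Tensor D N, ((∫ ω : FieldCoords D N,
        fieldForm (fun i => hermitianOf (ω i)) T ^ k / c * fieldWeight ω) /
        (∫ ω : FieldCoords D N, fieldWeight ω)) * vectorWeight β T) /
        (∫ T : Tensor D N, vectorWeight β T) := by
  have hint := integrable_of_mem_adjoin hN hβ ((Algebra.adjoin ℂ (coordinateFunctions D N)).smul_mem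
    ((Algebra.adjoin ℂ (coordinateFunctions D N)).pow_mem fieldForm_mem_adjoin k) c⁻¹)
  have hswap := integral_integral_swap (f := fun (ω : FieldCoords D N) (T : Tensor D N) =>
    (c⁻¹ * fieldForm (fun i => hermitianOf (ω i)) T ^ k) * (fieldWeight ω * vectorWeight β T)) hint
  have h1 (ω : FieldCoords D N) : ∫ T : Tensor D N,
      (c⁻¹ * fieldForm (fun i => hermitianOf (ω i)) T ^ k) * (fieldWeight ω * vectorWeight β T) =
      (∫ T : Tensor D N, fieldForm (fun i => hermitianOf (ω i)) T ^ k / c * vectorWeight β T) *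
        fieldWeight ω := by
    rw [← integral_mul_const]
    congr 1
    funext T
    ring
  have h2 (T : Tensor D N) : ∫ ω : FieldCoords D N,
      (c⁻¹ * fieldForm (fun i => hermitianOf (ω i)) T ^ k) * (fieldWeight ω * vectorWeight β T) =
      (∫ ω : FieldCoords D N, fieldForm (fun i => hermitianOf (ω i)) T ^ k / c * fieldWeight ω) *
        vectorWeight β T := by
    rw [← integral_mul_const]
    congr 1
    funext ω
    ring
  simp only [h1, h2, div_mul_eq_mul_div, integral_div] at hswap
  simp only [div_mul_eq_mul_div, integral_div]
  rw [hswap, div_right_comm]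

/-! ### The tensor model -/

/-- This identity fixes the normalisation of the root coupling: the square comes from `e^{c²/(4b)}`,
the `2N` from the matrix covariance, and the result is the quartic coupling. -/
theorem coupling_sq (hN : 1 ≤ N) {κ : ℝ} (hκ : 0 < κ) :
    (-Complex.I * ((κ⁻¹ * (√(2 * (N : ℝ) ^ ((D : ℤ) - 2)))⁻¹ : ℝ) : ℂ) *
      ((κ * (N : ℝ) ^ ((D : ℤ) - 1) : ℝ) : ℂ)) ^ 2 / (2 * N) =
      -((N : ℂ) ^ ((D : ℤ) - 1) / 4) := by
  have hN0 : (0 : ℝ) < N := by exact_mod_cast hN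
  have hN' : (N : ℂ) ≠ 0 := by exact_mod_cast hN0.ne'
  have hz : (N : ℝ) ^ ((D : ℤ) - 1) = (N : ℝ) ^ ((D : ℤ) - 2) * N := by
    rw [← zpow_add_one₀ hN0.ne']
    congr 1
    ring
  have hc : (N : ℂ) ^ ((D : ℤ) - 1) = (((N : ℝ) ^ ((D : ℤ) - 1) : ℝ) : ℂ) := by
    push_cast
    rfl
  have hu : (0 : ℝ) < (N : ℝ) ^ ((D : ℤ) - 2) := zpow_pos hN0 _
  rw [hc, hz]
  generalize (N : ℝ) ^ ((D : ℤ) - 2) = u at hu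
  have hr : ((κ⁻¹ * (√(2 * u))⁻¹) * (κ * (u * N))) ^ 2 = u * N ^ 2 / 2 := by
    have hs : √(2 * u) ^ 2 = 2 * u := Real.sq_sqrt (by positivity)
    have hs0 : √(2 * u) ≠ 0 := (Real.sqrt_pos.2 (by positivity)).ne'
    field_simp
    rw [hs]
  rw [mul_assoc, mul_pow, neg_sq, Complex.I_sq, ← Complex.ofReal_mul, ← Complex.ofReal_pow, hr]
  push_cast
  field_simp
  ring

theorem expand_tensorPartition (hN : 1 ≤ N) {κ : ℝ} (hκ : 0 < κ) :
    PowerSeries.expand 2 two_ne_zero (tensorPartition D N κ) =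
      MvPowerSeries.constantCoeff (opExp opX (opExp (opY N κ) (matrixProduct D N))) := by
  have hβ : 0 < κ * (N : ℝ) ^ ((D : ℤ) - 1) := by
    have : (0 : ℝ) < N := by exact_mod_cast hN
    positivity
  ext k
  rw [matrixProduct_eq hN, coeff_constantCoeff_opExp_sourceSeries, fieldExpect_apply]
  simp only [evalField_symbolY_exp hN hκ, mul_assoc (_ ^ k)]
  rw [integral_const_mul, mul_div_assoc]
  simp only [tensorExpect_eq]
  rw [integral_fieldForm_swap hN hβ]
  have h (T : Tensor D N) := congrArg (PowerSeries.coeff k) (mk_integral_fieldForm hN T)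
  simp only [PowerSeries.coeff_mk] at h
  simp only [h, PowerSeries.coeff_expand]
  -- Odd orders in `√λ` vanish on both sides; the order `2 j` in `√λ` is the order `j` in `λ`.
  split_ifs with hk
  · obtain ⟨j, rfl⟩ := hk
    rw [Nat.mul_div_cancel_left j two_pos, tensorPartition, PowerSeries.coeff_mk, tensorExpect_eq,
      ← mul_div_assoc, ← integral_const_mul, ← coupling_sq hN hκ]
    congr 2
    funext T
    rw [coeff_rescale_exp, pow_mul, ← mul_assoc, ← mul_div_assoc, ← mul_pow]
    congr 3
    ring
  · simp

end Expectation

end QuarticTensor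

end

theorem theorem1 (D N : ℕ) (hD : 1 ≤ D) (hN : 1 ≤ N) (κ : ℝ) (hκ : 0 < κ) :
    -- all the series below converge coefficientwise
    (∀ F : TimeSeries D,
      Summable (eulerTerm F) ∧ Summable (termY N κ F) ∧
      Summable (expTerm opX F) ∧ Summable (expTerm (opY N κ) F) ∧
      Summable (expTerm (opO N κ) F)) ∧
    -- the decomposition of the tensor model, at vanishing times
    PowerSeries.expand 2 two_ne_zero (tensorPartition D N κ) =
      MvPowerSeries.constantCoeff (opExp opX (opExp (opY N κ) (matrixProduct D N))) ∧
    PowerSeries.expand 2 two_ne_zero (tensorPartition D N κ) =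
      MvPowerSeries.constantCoeff (opExp (opO N κ) (matrixProduct D N)) ∧
    -- the two exponentials collapse to one, as operators: `e^Ô = e^X̂ e^Ŷ` and `Ô = ln (e^X̂ e^Ŷ)`
    (∀ F : TimeSeries D, opX (opY N κ F) - opY N κ (opX F) = (D : ℂ) • opY N κ F) ∧
    (∀ F : TimeSeries D, opExp (opO N κ) F = opExp opX (opExp (opY N κ) F)) ∧
    (∀ F : TimeSeries D,
      HasSum (logTerm (fun G => opExp opX (opExp (opY N κ) G)) F) (opO N κ F)) ∧
    (∀ F : TimeSeries D,
      opO N κ F = opX F + (((D : ℝ) / (1 - Real.exp (-(D : ℝ))) : ℝ) : ℂ) • opY N κ F) := by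
  refine ⟨fun F => ⟨(hasSum_eulerTerm F).summable, (hasSum_termY F).summable,
    (hasSum_expTerm_opX F).summable, (hasSum_expTerm_opY F).summable,
    (hasSum_expTerm_opO hD F).summable⟩, expand_tensorPartition hN hκ, ?_, opX_opY_commutator,
    opExp_opO hD, hasSum_logTerm hD, opO_eq hD⟩
  rw [opExp_opO hD]
  exact expand_tensorPartition hN hκ
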